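/- Let $X$ be a complex Banach space and let $T$ be a bounded linear operator on $X$ which is power-bounded, i.e. $\sup_{n\ge 0}\|T^n\|<\infty$, and satisfies $\sigma(T)\cap\mathbb{T}\subseteq\{1\}$, where $\sigma(T)$ is the spectrum of $T$ and $\mathbb{T}=\{\lambda\in\mathbb{C}:|\lambda|=1\}$. Write $R(\lambda,T)=(\lambda I-T)^{-1}$ for $\lambda\in\mathbb{C}\setminus\sigma(T)$. Let $m\colon(0,\pi]\to(0,\infty)$ be a continuous, non-increasing function such that $$\|R(e^{i\theta},T)\|\le m(|\theta|)\qquad\text{whenever } |\theta|\in(0,\pi].$$ Define $m_{\log}\colon(0,\pi]\to(0,\infty)$ by $$m_{\log}(\epsilon)=m(\epsilon)\log\left(1+\frac{m(\epsilon)}{\epsilon}\right),$$ which is a strictly decreasing bijection of $(0,\pi]$ onto $[m_{\log}(\pi),\infty)$, and let $m_{\log}^{-1}\colon[m_{\log}(\pi),\infty)\to(0,\pi]$ be its inverse. Then, for every $c\in(0,1)$, $$\|T^n(I-T)\|=O\big(m_{\log}^{-1}(cn)\big),\qquad n\to\infty.$$ -/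

import Mathlib

open Set Filter Topology Asymptotics

/-- `T` is power-bounded: `sup_{n ≥ 0} ‖T ^ n‖ < ∞`. -/
def IsPowerBounded {X : Type*} [NormedAddCommGroup X] [NormedSpace ℂ X] (T : X →L[ℂ] X) : Prop :=
  ∃ K : ℝ, ∀ n : ℕ, ‖T ^ n‖ ≤ K

/-- `m_log(ε) = m(ε) log (1 + m(ε) / ε)`. -/
noncomputable def mLog (m : ℝ → ℝ) (ε : ℝ) : ℝ :=
  m ε * Real.log (1 + m ε / ε)

/-- The inverse function of `m_log : (0, δ] → [m_log(δ), ∞)`. It is a genuine inverse for `m`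
continuous, positive and non-increasing on `(0, δ]`, see `mLog_bijOn` and `mLogInv_invOn`;
outside `[m_log(δ), ∞)` the value has no meaning. -/
noncomputable def mLogInv (m : ℝ → ℝ) (δ : ℝ) (t : ℝ) : ℝ :=
  Function.invFunOn (mLog m) (Ioc 0 δ) t

theorem mLog_strictAntiOn (m : ℝ → ℝ) (δ : ℝ) (hpos : ∀ ε ∈ Ioc 0 δ, 0 < m ε)
    (hanti : AntitoneOn m (Ioc 0 δ)) : StrictAntiOn (mLog m) (Ioc 0 δ) := by
  intro a ha b hb hab
  have h1 : m b ≤ m a := hanti ha hb hab.le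
  have hmb := hpos b hb
  have hma := hpos a ha
  have ha0 : 0 < a := ha.1
  have hb0 : 0 < b := hb.1
  have h2 : m b / b < m a / a :=
    (div_lt_div_of_pos_left hmb ha0 hab).trans_le (by gcongr)
  have h3 : 0 < m b / b := div_pos hmb hb0
  have h4 : Real.log (1 + m b / b) < Real.log (1 + m a / a) :=
    Real.log_lt_log (by linarith) (by linarith)
  have h5 : 0 ≤ Real.log (1 + m b / b) := Real.log_nonneg (by linarith)
  exact mul_lt_mul' h1 h4 h5 hma

theorem mLog_bijOn (m : ℝ → ℝ) (δ : ℝ) (hδ : 0 < δ) (hcont : ContinuousOn m (Ioc 0 δ))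
    (hpos : ∀ ε ∈ Ioc 0 δ, 0 < m ε) (hanti : AntitoneOn m (Ioc 0 δ)) :
    BijOn (mLog m) (Ioc 0 δ) (Ici (mLog m δ)) := by
  have hδmem : δ ∈ Ioc 0 δ := ⟨hδ, le_rfl⟩
  have hsa := mLog_strictAntiOn m δ hpos hanti
  refine ⟨fun ε hε => hsa.antitoneOn hε hδmem hε.2, hsa.injOn, ?_⟩
  intro t ht
  have hd := hpos δ hδmem
  -- a point `a` at which `m_log(a) ≥ t`
  set a : ℝ := min δ (m δ / Real.exp (t / m δ)) with ha_def
  have ha0 : 0 < a := lt_min hδ (by positivity)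
  have haδ : a ≤ δ := min_le_left _ _
  have hamem : a ∈ Ioc 0 δ := ⟨ha0, haδ⟩
  have hm : m δ ≤ m a := hanti hamem hδmem haδ
  have hma := hpos a hamem
  have h1 : Real.exp (t / m δ) ≤ m a / a := by
    rw [le_div_iff₀ ha0]
    have h := min_le_right δ (m δ / Real.exp (t / m δ))
    rw [← ha_def, le_div_iff₀ (Real.exp_pos _)] at h
    linarith
  have hq : 0 < m a / a := div_pos hma ha0
  have h2 : t / m δ ≤ Real.log (1 + m a / a) := by
    rw [Real.le_log_iff_exp_le (by linarith)]
    linarith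
  have h3 : 0 ≤ Real.log (1 + m a / a) := Real.log_nonneg (by linarith)
  have h4 : t ≤ mLog m a := by
    rw [div_le_iff₀ hd] at h2
    unfold mLog
    nlinarith
  have hsub : Icc a δ ⊆ Ioc 0 δ := fun x hx => ⟨ha0.trans_le hx.1, hx.2⟩
  have hc : ContinuousOn (mLog m) (Icc a δ) := by
    have hmc := hcont.mono hsub
    refine hmc.mul (ContinuousOn.log (continuousOn_const.add
      (hmc.div continuousOn_id fun x hx => (hsub hx).1.ne')) fun x hx => ?_)
    have := div_pos (hpos x (hsub hx)) (hsub hx).1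
    linarith
  exact image_mono hsub (intermediate_value_Icc' haδ hc ⟨ht, h4⟩)

theorem mLogInv_invOn (m : ℝ → ℝ) (δ : ℝ) (hδ : 0 < δ) (hcont : ContinuousOn m (Ioc 0 δ))
    (hpos : ∀ ε ∈ Ioc 0 δ, 0 < m ε) (hanti : AntitoneOn m (Ioc 0 δ)) :
    InvOn (mLogInv m δ) (mLog m) (Ioc 0 δ) (Ici (mLog m δ)) :=
  (mLog_bijOn m δ hδ hcont hpos hanti).invOn_invFunOn

/-!
Write `R(z)` for the resolvent of `T`, put `z = e^{i(x + iy)}`, so that `|z| = e^{-y}`, and fix a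
small `ε > 0`. The kernel `arcKernel ε`, here `h`, is `1` at infinity, vanishes at `e^{±iε}`, is
bounded on all contours used below and has its only pole in the open unit disc, near `1`. Hence
`2π Tⁿ (1 - T)` is the integral of `z h(z) Tⁿ (1 - T) R(z)` over the circle `y = -ε`
(`integral_tailIntegrand`).

* The part of this circle with `|x| ≤ ε` contributes `O(ε)`, because `‖R(z)‖ ≤ K / (|z| - 1)` and
  hence `(1 - T) R(z) = 1 + (1 - z) R(z)` is bounded there.
* The rest is moved onto the unit circle. The vertical sides cost `O(ε)`, since the zeros of `h`
  compensate the blow-up of `R`.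
* On the unit circle `Tⁿ R(z) = zⁿ R(z) - P(z)` with `P(z) = (zⁿ - Tⁿ) / (z - T)` a polynomial in
  `z`. By the Neumann series, with `M` a bound of `R` on the arc `ε ≤ |x| ≤ π`, the first term can
  be pushed into the unit disc up to `y = c / M`. It contributes `O((1 + M) e^{-cn/M})` at that
  height and `O((1 + ε M) / n)` on the vertical sides. The polynomial term is pushed to `y = 2ε`,
  where its integral over the full circle is zero, so that only an arc with `|x| ≤ ε` and the
  vertical sides remain; both are `O(ε)`.

The result is `norm_pow_mul_one_sub_le`:
`‖Tⁿ (1 - T)‖ ≤ C (ε + (1 + M) e^{-cn/M} + (1 + ε M) / n)`.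
If `1` is in the spectrum then `m(ε) ≥ 1 / ε`, and with `M = m(ε)` and `m_log(ε) = c n`, that is
`e^{-cn/M} = 1 / (1 + m(ε) / ε)`, all three terms are `O(ε)`. If `1` is not in the spectrum then the
spectral radius `r` is less than `1`, and `m(ε)` is at least about `1 / (1 - r)` for small `ε`, since
the resolvent at distance `d` from the spectrum has norm at least `1 / d`. The strict inequality
`r < e^{-c (1 - r)}` and Gelfand's formula then give the rate.
-/

/-! ### Resolvents in a Banach algebra -/

section BanachAlgebra

variable {A : Type*} [NormedRing A] [NormedAlgebra ℂ A] {T : A}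

theorem resolvent_mul_self_left {z : ℂ} (hz : z ∈ resolventSet ℂ T) :
    (z • (1 : A) - T) * resolvent T z = 1 := by
  rw [← Algebra.algebraMap_eq_smul_one]
  exact Ring.mul_inverse_cancel _ hz

theorem resolvent_mul_self_right {z : ℂ} (hz : z ∈ resolventSet ℂ T) :
    resolvent T z * (z • (1 : A) - T) = 1 := by
  rw [← Algebra.algebraMap_eq_smul_one]
  exact Ring.inverse_mul_cancel _ hz

theorem resolvent_of_mul_eq_one {z : ℂ} {S : A} (h₁ : (z • (1 : A) - T) * S = 1)
    (h₂ : S * (z • (1 : A) - T) = 1) : z ∈ resolventSet ℂ T ∧ resolvent T z = S := by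
  have hu : IsUnit (z • (1 : A) - T) := ⟨⟨_, S, h₁, h₂⟩, rfl⟩
  rw [← Algebra.algebraMap_eq_smul_one] at hu
  have hz : z ∈ resolventSet ℂ T := hu
  refine ⟨hz, ?_⟩
  calc resolvent T z = resolvent T z * ((z • (1 : A) - T) * S) := by rw [h₁, mul_one]
    _ = S := by rw [← mul_assoc, resolvent_mul_self_right hz, one_mul]

theorem one_sub_mul_resolvent {z : ℂ} (hz : z ∈ resolventSet ℂ T) :
    (1 - T) * resolvent T z = 1 + (1 - z) • resolvent T z := by
  have h := resolvent_mul_self_left hz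
  rw [sub_mul, smul_mul_assoc, one_mul] at h
  rw [sub_mul, one_mul, sub_smul, one_smul, ← h]
  abel

/-- The polynomial `(zⁿ - Tⁿ) / (z - T)`. -/
noncomputable def resolventPoly (T : A) (n : ℕ) (z : ℂ) : A :=
  ∑ i ∈ Finset.range n, z ^ i • T ^ (n - 1 - i)

theorem resolventPoly_mul (T : A) (n : ℕ) (z : ℂ) :
    resolventPoly T n z * (z • (1 : A) - T) = z ^ n • (1 : A) - T ^ n := by
  have h := Commute.geom_sum₂_mul (show Commute (algebraMap ℂ A z) T from Algebra.commutes z T) n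
  simpa only [resolventPoly, Algebra.algebraMap_eq_smul_one, smul_pow, one_pow,
    smul_mul_assoc, one_mul] using h

theorem commute_resolventPoly (T : A) (n : ℕ) (z : ℂ) : Commute T (resolventPoly T n z) :=
  Commute.sum_right _ _ _ fun _ _ => ((Commute.refl T).pow_right _).smul_right _

theorem pow_mul_resolvent {z : ℂ} (hz : z ∈ resolventSet ℂ T) (n : ℕ) :
    T ^ n * resolvent T z = z ^ n • resolvent T z - resolventPoly T n z := by
  have h := resolventPoly_mul T n z
  have h2 : resolventPoly T n z = (z ^ n • (1 : A) - T ^ n) * resolvent T z := by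
    rw [← h, mul_assoc, resolvent_mul_self_left hz, mul_one]
  rw [h2, sub_mul, smul_mul_assoc, one_mul]
  abel

theorem pow_mul_one_sub_mul_resolvent {z : ℂ} (hz : z ∈ resolventSet ℂ T) (n : ℕ) :
    T ^ n * ((1 - T) * resolvent T z) =
      z ^ n • ((1 - T) * resolvent T z) - (1 - T) * resolventPoly T n z := by
  have hc : T ^ n * (1 - T) = (1 - T) * T ^ n :=
    ((Commute.one_right _).sub_right ((Commute.refl T).pow_left n)).eq
  rw [← mul_assoc, hc, mul_assoc, pow_mul_resolvent hz, mul_sub, mul_smul_comm]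

theorem norm_one_sub_mul_resolventPoly_le {K : ℝ} (hK : ∀ n : ℕ, ‖T ^ n‖ ≤ K) (n : ℕ) {z : ℂ}
    (hz : ‖z‖ < 1) :
    ‖(1 - T) * resolventPoly T n z‖ ≤ ‖1 - z‖ * (K / (1 - ‖z‖)) + 2 * K := by
  have hK0 : 0 ≤ K := (norm_nonneg _).trans (hK 0)
  have hP : ‖resolventPoly T n z‖ ≤ K / (1 - ‖z‖) := by
    calc ‖resolventPoly T n z‖ ≤ ∑ i ∈ Finset.range n, ‖z‖ ^ i * K := by
          refine norm_sum_le_of_le _ fun i _ => ?_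
          rw [norm_smul, norm_pow]
          gcongr
          exact hK _
      _ = (∑ i ∈ Finset.range n, ‖z‖ ^ i) * K := by rw [Finset.sum_mul]
      _ ≤ (1 - ‖z‖)⁻¹ * K := by
          gcongr
          rw [← tsum_geometric_of_lt_one (norm_nonneg _) hz]
          exact (summable_geometric_of_lt_one (norm_nonneg _) hz).sum_le_tsum _
            fun _ _ => by positivity
      _ = _ := by rw [div_eq_inv_mul]
  have e : (1 - T) * resolventPoly T n z =
      (1 - z) • resolventPoly T n z + (z ^ n • T ^ 0 - T ^ n) := by
    have h := resolventPoly_mul T n z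
    rw [mul_sub, mul_smul_comm, mul_one, ← (commute_resolventPoly T n z).eq] at h
    rw [sub_mul, one_mul, sub_smul, one_smul, pow_zero, ← h]
    abel
  rw [e]
  refine (norm_add_le _ _).trans ?_
  rw [norm_smul]
  have h1 : ‖z ^ n • T ^ 0 - T ^ n‖ ≤ 2 * K := by
    refine (norm_sub_le _ _).trans ?_
    rw [norm_smul, norm_pow]
    have := mul_le_mul (pow_le_one₀ (n := n) (norm_nonneg z) hz.le) (hK 0) (norm_nonneg _) zero_le_one
    linarith [hK n]
  gcongr

theorem differentiable_resolventPoly (T : A) (n : ℕ) : Differentiable ℂ (resolventPoly T n) := by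
  unfold resolventPoly
  fun_prop

theorem inverse_one_sub_inv_smul {z : ℂ} (hz : z ≠ 0) :
    Ring.inverse (1 - z⁻¹ • T) = z • resolvent T z := by
  have := spectrum.units_smul_resolvent_self (r := Units.mk0 z hz) (a := T)
  rw [Units.smul_def, Units.smul_def] at this
  rw [Units.val_inv_eq_inv_val, Units.val_mk0] at this
  rw [this, resolvent, map_one]

variable [CompleteSpace A]

theorem summable_inv_smul_pow {K : ℝ} (hK : ∀ n : ℕ, ‖T ^ n‖ ≤ K) {z : ℂ} (hz : 1 < ‖z‖) :
    Summable (fun n : ℕ => (z⁻¹ • T) ^ n) ∧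
      ‖∑' n : ℕ, (z⁻¹ • T) ^ n‖ ≤ (1 - ‖z‖⁻¹)⁻¹ * K := by
  have h0 : 0 ≤ ‖z‖⁻¹ := by positivity
  have h1 : ‖z‖⁻¹ < 1 := inv_lt_one_of_one_lt₀ hz
  have hg := (hasSum_geometric_of_lt_one h0 h1).mul_right K
  have hb : ∀ n : ℕ, ‖(z⁻¹ • T) ^ n‖ ≤ ‖z‖⁻¹ ^ n * K := fun n => by
    rw [smul_pow, norm_smul, norm_pow, norm_inv]
    exact mul_le_mul_of_nonneg_left (hK n) (by positivity)
  exact ⟨Summable.of_norm_bounded hg.summable hb, tsum_of_norm_bounded hg hb⟩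

/-- The resolvent of a power-bounded element outside the closed unit disc (Kreiss condition). -/
theorem resolvent_bound_of_one_lt {K : ℝ} (hK : ∀ n : ℕ, ‖T ^ n‖ ≤ K) {z : ℂ} (hz : 1 < ‖z‖) :
    z ∈ resolventSet ℂ T ∧ ‖resolvent T z‖ ≤ K / (‖z‖ - 1) := by
  obtain ⟨hs, hb⟩ := summable_inv_smul_pow hK hz
  have hz0 : z ≠ 0 := by rintro rfl; simp at hz; linarith
  set S : A := ∑' n : ℕ, (z⁻¹ • T) ^ n
  have e : z • (1 : A) - T = z • (1 - z⁻¹ • T) := by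
    rw [smul_sub, smul_smul, mul_inv_cancel₀ hz0, one_smul]
  obtain ⟨h1, h2⟩ := resolvent_of_mul_eq_one (T := T) (z := z) (S := z⁻¹ • S)
    (by rw [e, smul_mul_smul_comm, mul_inv_cancel₀ hz0, one_smul, hs.one_sub_mul_tsum_pow])
    (by rw [e, smul_mul_smul_comm, inv_mul_cancel₀ hz0, one_smul, hs.tsum_pow_mul_one_sub])
  refine ⟨h1, ?_⟩
  rw [h2, norm_smul, norm_inv]
  have hz' : (0 : ℝ) < ‖z‖ := by linarith
  have hz'' : ‖z‖ - 1 ≠ 0 := by linarith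
  calc ‖z‖⁻¹ * ‖S‖ ≤ ‖z‖⁻¹ * ((1 - ‖z‖⁻¹)⁻¹ * K) := by gcongr
    _ = K / (‖z‖ - 1) := by
      have : 1 - ‖z‖⁻¹ ≠ 0 := by
        have := inv_lt_one_of_one_lt₀ hz
        linarith
      field_simp

/-- Perturbation of the resolvent by a Neumann series. -/
theorem resolvent_bound_of_near {z w : ℂ} (hz : z ∈ resolventSet ℂ T) {c : ℝ} (hc : c < 1)
    (h : ‖w - z‖ * ‖resolvent T z‖ ≤ c) :
    w ∈ resolventSet ℂ T ∧ ‖resolvent T w‖ ≤ ‖resolvent T z‖ / (1 - c) := by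
  set R := resolvent T z with hR
  set x : A := (z - w) • R with hx
  have hxn : ‖x‖ < 1 := by
    rw [hx, norm_smul, norm_sub_rev]
    linarith
  have hl := resolvent_mul_self_left hz
  have hr := resolvent_mul_self_right hz
  have e1 : w • (1 : A) - T = (z • (1 : A) - T) * (1 - x) := by
    rw [mul_sub, mul_one, hx, mul_smul_comm, hl, sub_smul]
    abel
  have e2 : w • (1 : A) - T = (1 - x) * (z • (1 : A) - T) := by
    rw [sub_mul, one_mul, hx, smul_mul_assoc, hr, sub_smul]
    abel
  set S : A := ∑' n : ℕ, x ^ n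
  have s1 : (1 - x) * S = 1 := mul_neg_geom_series x hxn
  have s2 : S * (1 - x) = 1 := geom_series_mul_neg x hxn
  have hcomm : Commute x R := by
    rw [hx]; exact (Commute.refl R).smul_left _
  obtain ⟨h1, h2⟩ := resolvent_of_mul_eq_one (T := T) (z := w) (S := S * R)
    (by
      rw [e2]
      have : (z • (1 : A) - T) * (S * R) = S := by
        have hTS : (z • (1 : A) - T) * S = S * (z • (1 : A) - T) := by
          calc (z • (1 : A) - T) * S = S * (1 - x) * ((z • (1 : A) - T) * S) := by rw [s2, one_mul]
            _ = S * ((1 - x) * (z • (1 : A) - T)) * S := by simp only [mul_assoc]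
            _ = S * ((z • (1 : A) - T) * (1 - x)) * S := by rw [← e2, e1]
            _ = S * (z • (1 : A) - T) * ((1 - x) * S) := by simp only [mul_assoc]
            _ = S * (z • (1 : A) - T) := by rw [s1, mul_one]
        rw [← mul_assoc, hTS, mul_assoc, hl, mul_one]
      rw [mul_assoc, this, s1])
    (by rw [e1, mul_assoc, ← mul_assoc R, hr, one_mul, s2])
  refine ⟨h1, ?_⟩
  have hc' : 0 < 1 - c := by linarith
  -- `S = 1 + x S` bounds `S R` without the factor `‖1‖` of the norm of a geometric series
  have e3 : S * R = R + x * (S * R) := by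
    have : S = 1 + x * S := by
      have := s1
      rw [sub_mul, one_mul] at this
      rw [← this]; abel
    conv_lhs => rw [this]
    rw [add_mul, one_mul, mul_assoc]
  have hxc : ‖x‖ ≤ c := by rw [hx, norm_smul, norm_sub_rev]; exact h
  have h3 : ‖S * R‖ ≤ ‖R‖ + c * ‖S * R‖ := by
    calc ‖S * R‖ = ‖R + x * (S * R)‖ := by rw [← e3]
      _ ≤ ‖R‖ + ‖x‖ * ‖S * R‖ := (norm_add_le _ _).trans (by gcongr; exact norm_mul_le _ _)
      _ ≤ _ := by gcongr
  rw [h2, le_div_iff₀ hc']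
  linarith

/-- At distance `d` from a spectral value the resolvent has norm at least `1 / d`. -/
theorem one_le_dist_mul_norm_resolvent {z w : ℂ} (hz : z ∈ resolventSet ℂ T)
    (hw : w ∈ spectrum ℂ T) : 1 ≤ ‖w - z‖ * ‖resolvent T z‖ := by
  by_contra! h
  exact hw (resolvent_bound_of_near hz h le_rfl).1

theorem differentiableAt_resolvent {z : ℂ} (hz : z ∈ resolventSet ℂ T) :
    DifferentiableAt ℂ (resolvent T) z :=
  (spectrum.hasDerivAt_resolvent_const_left hz).differentiableAt

theorem spectralRadius_le_one_of_powerBounded {K : ℝ} (hK : ∀ n : ℕ, ‖T ^ n‖ ≤ K) :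
    spectralRadius ℂ T ≤ 1 := by
  refine iSup₂_le fun z hz => ?_
  by_contra! h
  refine hz (resolvent_bound_of_one_lt hK ?_).1
  exact_mod_cast h

theorem differentiableOn_inverse_one_sub_smul_of_powerBounded {K : ℝ} (hK : ∀ n : ℕ, ‖T ^ n‖ ≤ K)
    {r : ℝ} (hr : r < 1) :
    DifferentiableOn ℂ (fun w : ℂ => Ring.inverse (1 - w • T)) (Metric.closedBall 0 r) := by
  rcases lt_or_ge r 0 with h | h
  · rw [Metric.closedBall_eq_empty.2 h]
    exact differentiableOn_empty
  lift r to NNReal using h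
  refine spectrum.differentiableOn_inverse_one_sub_smul ?_
  refine lt_of_lt_of_le ?_ (ENNReal.one_le_inv.2 (spectralRadius_le_one_of_powerBounded hK))
  exact_mod_cast hr

end BanachAlgebra

/-! ### Contour integrals in logarithmic coordinates -/

section Contours

variable {E : Type*} [NormedAddCommGroup E] [NormedSpace ℂ E]

/-- Moving a horizontal segment of integration from height `y₀` to height `y₁` costs at most the
integrals over the two vertical sides. -/
theorem norm_integral_horizontal_le {g : ℂ → E} {a b y₀ y₁ : ℝ}
    (hg : DifferentiableOn ℂ g (uIcc a b ×ℂ uIcc y₀ y₁)) {B L R : ℝ}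
    (hB : ‖∫ x in a..b, g (x + y₁ * Complex.I)‖ ≤ B)
    (hL : ‖∫ y in y₀..y₁, g (a + y * Complex.I)‖ ≤ L)
    (hR : ‖∫ y in y₀..y₁, g (b + y * Complex.I)‖ ≤ R) :
    ‖∫ x in a..b, g (x + y₀ * Complex.I)‖ ≤ B + L + R := by
  have h := Complex.integral_boundary_rect_eq_zero_of_differentiableOn g
    (a + y₀ * Complex.I) (b + y₁ * Complex.I) (by simpa using hg)
  simp only [Complex.add_re, Complex.add_im, Complex.ofReal_re, Complex.ofReal_im, Complex.mul_re,
    Complex.mul_im, Complex.I_re, Complex.I_im, mul_zero, mul_one, sub_zero, add_zero, zero_add]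
    at h
  have h' : (∫ x in a..b, g (x + y₀ * Complex.I)) = (∫ x in a..b, g (x + y₁ * Complex.I)) +
      Complex.I • (∫ y in y₀..y₁, g (a + y * Complex.I)) -
      Complex.I • (∫ y in y₀..y₁, g (b + y * Complex.I)) := by
    rw [← sub_eq_zero, ← h]
    abel
  rw [h']
  refine (norm_sub_le _ _).trans ?_
  gcongr
  · refine (norm_add_le _ _).trans ?_
    gcongr
    rwa [norm_smul, Complex.norm_I, one_mul]
  · rwa [norm_smul, Complex.norm_I, one_mul]

theorem norm_exp_I_mul (x y : ℝ) :
    ‖Complex.exp (Complex.I * (x + y * Complex.I))‖ = Real.exp (-y) := by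
  rw [Complex.norm_exp]
  simp

variable [CompleteSpace E]

/-- Mean value property on the circle `|w| = e^{-y}`, in logarithmic coordinates. -/
theorem integral_exp_I_mul_eq {f : ℂ → E} {y : ℝ} (a : ℝ)
    (hf : DifferentiableOn ℂ f (Metric.closedBall 0 (Real.exp (-y)))) :
    ∫ x in a..a + 2 * Real.pi, f (Complex.exp (Complex.I * (x + y * Complex.I))) =
      (2 * Real.pi) • f 0 := by
  have e : ∀ x : ℝ, Complex.exp (Complex.I * (x + y * Complex.I)) =
      circleMap 0 (Real.exp (-y)) x := fun x => by
    rw [circleMap, zero_add, Complex.ofReal_exp, ← Complex.exp_add]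
    congr 1
    push_cast
    linear_combination (y : ℂ) * Complex.I_sq
  simp_rw [e]
  have hp : Function.Periodic (fun x : ℝ => f (circleMap 0 (Real.exp (-y)) x)) (2 * Real.pi) :=
    fun x => by simp only [(periodic_circleMap 0 (Real.exp (-y))) x]
  rw [hp.intervalIntegral_add_eq a 0, zero_add]
  have h : DiffContOnCl ℂ f (Metric.ball 0 |Real.exp (-y)|) := by
    rw [abs_of_pos (Real.exp_pos _)]
    exact DifferentiableOn.diffContOnCl_ball (U := Metric.closedBall 0 (Real.exp (-y))) hf le_rfl
  have h2 := h.circleAverage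
  rw [Real.circleAverage_def] at h2
  rw [← h2, smul_smul, mul_inv_cancel₀ (by positivity), one_smul]

/-- Mean value property at infinity, in logarithmic coordinates. -/
theorem integral_exp_I_mul_inv_eq {f : ℂ → E} {y : ℝ} (a : ℝ)
    (hf : DifferentiableOn ℂ f (Metric.closedBall 0 (Real.exp y))) :
    ∫ x in a..a + 2 * Real.pi, f (Complex.exp (Complex.I * (x + y * Complex.I)))⁻¹ =
      (2 * Real.pi) • f 0 := by
  have e : ∀ x : ℝ, (Complex.exp (Complex.I * (x + y * Complex.I)))⁻¹ =
      Complex.exp (Complex.I * (((-x : ℝ) : ℂ) + ((-y : ℝ) : ℂ) * Complex.I)) := fun x => by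
    rw [← Complex.exp_neg]
    congr 1
    push_cast
    ring
  simp_rw [e]
  rw [intervalIntegral.integral_comp_neg
    (fun x : ℝ => f (Complex.exp (Complex.I * ((x : ℂ) + ((-y : ℝ) : ℂ) * Complex.I))))]
  have h := integral_exp_I_mul_eq (f := f) (y := -y) (-(a + 2 * Real.pi)) (by rwa [neg_neg])
  rwa [show -(a + 2 * Real.pi) + 2 * Real.pi = -a by ring] at h

end Contours

/-! ### The kernel -/

section Kernel

/-- The Newman-type kernel `(z - e^{iε}) (z - e^{-iε}) / (z - e^{-ε})²`: it vanishes at `e^{±iε}`,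
its only pole lies in the open unit disc at distance about `ε` from `1`, and it tends to `1` at
infinity. -/
noncomputable def arcKernel (ε : ℝ) (z : ℂ) : ℂ :=
  (z - Complex.exp (Complex.I * ε)) * (z - Complex.exp (-(Complex.I * ε))) /
    (z - Real.exp (-ε)) ^ 2

theorem norm_exp_neg_I_mul_ofReal_sub_one_le (x : ℝ) :
    ‖Complex.exp (-(Complex.I * x)) - 1‖ ≤ |x| := by
  have h := Real.norm_exp_I_mul_ofReal_sub_one_le (x := -x)
  simpa using h

variable {ε : ℝ} {z : ℂ}

/-- Away from the pole, both zeros of the kernel are at most about as far as the pole itself, since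
pole and zeros are within `2ε` of each other. -/
theorem norm_sub_exp_le (hε : 0 ≤ ε) (hz : ε / 10 ≤ ‖z - Real.exp (-ε)‖) :
    ‖z - Complex.exp (Complex.I * ε)‖ ≤ 21 * ‖z - Real.exp (-ε)‖ ∧
      ‖z - Complex.exp (-(Complex.I * ε))‖ ≤ 21 * ‖z - Real.exp (-ε)‖ := by
  have h1 : ‖((Real.exp (-ε) : ℝ) : ℂ) - 1‖ ≤ ε := by
    rw [← Complex.ofReal_one, ← Complex.ofReal_sub, Complex.norm_real, Real.norm_eq_abs, abs_le]
    constructor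
    · linarith [Real.add_one_le_exp (-ε)]
    · linarith [Real.exp_le_one_iff.2 (neg_nonpos.2 hε)]
  have key : ∀ w : ℂ, ‖w - 1‖ ≤ |ε| → ‖z - w‖ ≤ 21 * ‖z - Real.exp (-ε)‖ := fun w hw => by
    rw [abs_of_nonneg hε] at hw
    have e : z - w = (z - Real.exp (-ε)) + (((Real.exp (-ε) : ℝ) : ℂ) - 1) - (w - 1) := by ring
    have := (norm_sub_le ((z - Real.exp (-ε)) + (((Real.exp (-ε) : ℝ) : ℂ) - 1)) (w - 1))
    rw [← e] at this
    have h3 := norm_add_le (z - Real.exp (-ε)) (((Real.exp (-ε) : ℝ) : ℂ) - 1)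
    linarith
  exact ⟨key _ Real.norm_exp_I_mul_ofReal_sub_one_le, key _ (norm_exp_neg_I_mul_ofReal_sub_one_le ε)⟩

theorem norm_arcKernel_le (hε : 0 < ε) (hz : ε / 10 ≤ ‖z - Real.exp (-ε)‖) :
    ‖arcKernel ε z‖ ≤ 441 := by
  obtain ⟨h1, h2⟩ := norm_sub_exp_le hε.le hz
  have h0 : 0 < ‖z - Real.exp (-ε)‖ := by linarith
  rw [arcKernel, norm_div, norm_mul, norm_pow, div_le_iff₀ (by positivity)]
  calc _ ≤ (21 * ‖z - Real.exp (-ε)‖) * (21 * ‖z - Real.exp (-ε)‖) := by gcongr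
    _ = _ := by ring

/-- Near either zero the kernel is small. -/
theorem norm_arcKernel_le_of_near (hε : 0 < ε) (hz : ε / 10 ≤ ‖z - Real.exp (-ε)‖) {d : ℝ}
    (hd : ‖z - Complex.exp (Complex.I * ε)‖ ≤ d ∨ ‖z - Complex.exp (-(Complex.I * ε))‖ ≤ d) :
    ‖arcKernel ε z‖ ≤ 210 * d / ε := by
  obtain ⟨h1, h2⟩ := norm_sub_exp_le hε.le hz
  have h0 : 0 < ‖z - Real.exp (-ε)‖ := by linarith
  have hd0 : 0 ≤ d := by rcases hd with h | h <;> exact (norm_nonneg _).trans h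
  rw [arcKernel, norm_div, norm_mul, norm_pow, div_le_iff₀ (by positivity)]
  have h3 : ‖z - Complex.exp (Complex.I * ε)‖ * ‖z - Complex.exp (-(Complex.I * ε))‖ ≤
      d * (21 * ‖z - Real.exp (-ε)‖) := by
    rcases hd with h | h
    · gcongr
    · rw [mul_comm]
      gcongr
  refine h3.trans ?_
  have : (1 : ℝ) ≤ 10 * ‖z - Real.exp (-ε)‖ / ε := by
    rw [le_div_iff₀ hε]; linarith
  calc d * (21 * ‖z - Real.exp (-ε)‖) = d * (21 * ‖z - Real.exp (-ε)‖) * 1 := by ring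
    _ ≤ d * (21 * ‖z - Real.exp (-ε)‖) * (10 * ‖z - Real.exp (-ε)‖ / ε) := by gcongr
    _ = _ := by ring

theorem differentiableAt_arcKernel (hz : z ≠ Real.exp (-ε)) :
    DifferentiableAt ℂ (arcKernel ε) z := by
  unfold arcKernel
  have : (z - Real.exp (-ε)) ^ 2 ≠ 0 := pow_ne_zero _ (sub_ne_zero.2 hz)
  fun_prop (disch := assumption)

/-- In the sector `|arg z| ≥ ε` the pole of the kernel is at distance `≥ ε / 10`. -/
theorem le_norm_exp_sub_of_cos_le (hε : 0 < ε) (hε1 : ε ≤ 1) {x y : ℝ}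
    (hx : Real.cos x ≤ Real.cos ε) :
    ε / 10 ≤ ‖Complex.exp (Complex.I * (x + y * Complex.I)) - Real.exp (-ε)‖ := by
  set r := Real.exp (-y) with hr
  set ρ := Real.exp (-ε) with hρ
  have hr0 : 0 < r := Real.exp_pos _
  have hρ0 : 0 < ρ := Real.exp_pos _
  have e : Complex.exp (Complex.I * (x + y * Complex.I)) =
      ((r * Real.cos x : ℝ) : ℂ) + ((r * Real.sin x : ℝ) : ℂ) * Complex.I := by
    have : Complex.I * (x + y * Complex.I) = ((-y : ℝ) : ℂ) + x * Complex.I := by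
      push_cast
      linear_combination (y : ℂ) * Complex.I_sq
    rw [this, Complex.exp_add, Complex.exp_mul_I, ← Complex.ofReal_exp, ← hr]
    push_cast
    ring
  have e2 : Complex.exp (Complex.I * (x + y * Complex.I)) - ρ =
      ((r * Real.cos x - ρ : ℝ) : ℂ) + ((r * Real.sin x : ℝ) : ℂ) * Complex.I := by
    rw [e]; push_cast; ring
  rw [e2, Complex.norm_add_mul_I]
  apply Real.le_sqrt_of_sq_le
  have hs : 2 / Real.pi * ε ≤ Real.sin ε := Real.mul_le_sin hε.le (by linarith [Real.pi_gt_three])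
  have hs' : ε / 2 ≤ Real.sin ε := by
    refine le_trans ?_ hs
    have : 1 / 2 ≤ 2 / Real.pi := by
      rw [div_le_div_iff₀ two_pos Real.pi_pos]; linarith [Real.pi_lt_four]
    nlinarith
  have hρ1 : 1 / 3 ≤ ρ := by
    have h1 : Real.exp (-1) ≤ ρ := Real.exp_le_exp.2 (by linarith)
    have h2 : 1 / 3 ≤ Real.exp (-1) := by
      rw [Real.exp_neg, one_div]
      exact inv_anti₀ (Real.exp_pos _) (by linarith [Real.exp_one_lt_d9])
    linarith
  have hps : ε / 10 ≤ ρ * Real.sin ε := by nlinarith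
  have h1 : (ε / 10) ^ 2 ≤ (ρ * Real.sin ε) ^ 2 := by gcongr
  have h2 : (r * Real.cos x - ρ) ^ 2 + (r * Real.sin x) ^ 2 =
      r ^ 2 - 2 * r * ρ * Real.cos x + ρ ^ 2 := by
    linear_combination r ^ 2 * Real.sin_sq_add_cos_sq x
  have h3 : r * ρ * Real.cos x ≤ r * ρ * Real.cos ε := by gcongr
  have h4 : (ρ * Real.sin ε) ^ 2 + (r - ρ * Real.cos ε) ^ 2 =
      r ^ 2 - 2 * r * ρ * Real.cos ε + ρ ^ 2 := by
    linear_combination ρ ^ 2 * Real.sin_sq_add_cos_sq ε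
  have h5 := sq_nonneg (r - ρ * Real.cos ε)
  linarith

end Kernel

/-! ### Bounds on the contours -/

section ContourEstimates

theorem exp_I_mul_add_mul_I (x y : ℝ) : Complex.exp (Complex.I * (x + y * Complex.I)) =
    (Real.exp (-y) : ℂ) * Complex.exp (Complex.I * x) := by
  rw [Complex.ofReal_exp, ← Complex.exp_add]
  congr 1
  push_cast
  linear_combination (y : ℂ) * Complex.I_sq

theorem norm_exp_I_mul_sub (x y : ℝ) :
    ‖Complex.exp (Complex.I * (x + y * Complex.I)) - Complex.exp (Complex.I * x)‖ =
      |Real.exp (-y) - 1| := by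
  rw [exp_I_mul_add_mul_I, ← sub_one_mul, norm_mul, Complex.norm_exp_I_mul_ofReal, mul_one,
    ← Complex.ofReal_one, ← Complex.ofReal_sub, Complex.norm_real, Real.norm_eq_abs]

theorem norm_one_sub_exp_I_mul_le {x y d : ℝ} (hx : ‖Complex.exp (Complex.I * x) - 1‖ ≤ d) :
    ‖1 - Complex.exp (Complex.I * (x + y * Complex.I))‖ ≤ |Real.exp (-y) - 1| + d := by
  rw [← norm_exp_I_mul_sub x y, norm_sub_rev]
  exact (norm_sub_le_norm_sub_add_norm_sub _ (Complex.exp (Complex.I * x)) _).trans (by gcongr)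

/-- Angles in `[ε, 2π - ε]` reduced to angles of absolute value in `[ε, π]`. -/
theorem exists_reduced_angle {ε x : ℝ} (hε : 0 < ε) (hx : x ∈ Icc ε (2 * Real.pi - ε)) :
    Real.cos x ≤ Real.cos ε ∧ ∃ θ : ℝ, ε ≤ |θ| ∧ |θ| ≤ Real.pi ∧
      Complex.exp (Complex.I * x) = Complex.exp (Complex.I * θ) := by
  obtain ⟨θ, h1, h2, h3, h4⟩ : ∃ θ : ℝ, ε ≤ |θ| ∧ |θ| ≤ Real.pi ∧
      Complex.exp (Complex.I * x) = Complex.exp (Complex.I * θ) ∧ Real.cos x = Real.cos θ := by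
    rcases le_or_gt x Real.pi with h | h
    · have h0 : 0 ≤ x := hε.le.trans hx.1
      exact ⟨x, by rw [abs_of_nonneg h0]; exact hx.1, by rwa [abs_of_nonneg h0], rfl, rfl⟩
    · have h0 : x - 2 * Real.pi ≤ 0 := by linarith [hx.2]
      refine ⟨x - 2 * Real.pi, ?_, ?_, ?_, ?_⟩
      · rw [abs_of_nonpos h0]; linarith [hx.2]
      · rw [abs_of_nonpos h0]; linarith
      · have : Complex.I * ((x - 2 * Real.pi : ℝ) : ℂ) =
            Complex.I * x - 2 * Real.pi * Complex.I := by
          push_cast; ring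
        rw [this, Complex.exp_periodic.sub_eq]
      · rw [Real.cos_sub_two_pi]
  refine ⟨?_, θ, h1, h2, h3⟩
  rw [h4, ← Real.cos_abs θ]
  exact Real.cos_le_cos_of_nonneg_of_le_pi hε.le h2 h1

theorem exp_I_mul_two_pi_sub (ε : ℝ) :
    Complex.exp (Complex.I * ((2 * Real.pi - ε : ℝ) : ℂ)) = Complex.exp (-(Complex.I * ε)) := by
  have : Complex.I * ((2 * Real.pi - ε : ℝ) : ℂ) = -(Complex.I * ε) + 2 * Real.pi * Complex.I := by
    push_cast; ring
  rw [this, Complex.exp_periodic]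

theorem norm_arcKernel_vertical_le {ε x y : ℝ} (hε : 0 < ε) (hε1 : ε ≤ 1)
    (hx : x = ε ∨ x = 2 * Real.pi - ε) :
    ‖arcKernel ε (Complex.exp (Complex.I * (x + y * Complex.I)))‖ ≤
        210 * |Real.exp (-y) - 1| / ε ∧
      ‖1 - Complex.exp (Complex.I * (x + y * Complex.I))‖ ≤ |Real.exp (-y) - 1| + ε := by
  have hmem : x ∈ Icc ε (2 * Real.pi - ε) := by
    have := Real.pi_gt_three
    rcases hx with rfl | rfl <;> constructor <;> linarith
  have hlow := le_norm_exp_sub_of_cos_le (y := y) hε hε1 (exists_reduced_angle hε hmem).1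
  have hs := (norm_exp_I_mul_sub x y).le
  constructor
  · refine norm_arcKernel_le_of_near hε hlow ?_
    rcases hx with rfl | rfl
    · exact Or.inl hs
    · rw [exp_I_mul_two_pi_sub] at hs
      exact Or.inr hs
  · refine norm_one_sub_exp_I_mul_le ?_
    rw [← abs_of_pos hε]
    rcases hx with rfl | rfl
    · exact Real.norm_exp_I_mul_ofReal_sub_one_le.trans (by simp)
    · rw [exp_I_mul_two_pi_sub]
      simpa using norm_exp_neg_I_mul_ofReal_sub_one_le ε

variable {A : Type*} [NormedRing A] [NormedAlgebra ℂ A] {T : A} {K : ℝ}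

theorem norm_smul_one_sub_mul_resolvent_le (hK : ∀ n : ℕ, ‖T ^ n‖ ≤ K) {z : ℂ}
    (hz : z ∈ resolventSet ℂ T) {M d H : ℝ} (hM : ‖resolvent T z‖ ≤ M) (hd : ‖1 - z‖ ≤ d)
    {κ : ℂ} (hκ : ‖κ‖ ≤ H) (n : ℕ) :
    ‖(κ * z ^ (n + 1)) • ((1 - T) * resolvent T z)‖ ≤ H * ‖z‖ ^ (n + 1) * (K + d * M) := by
  have h1 : ‖(1 : A)‖ ≤ K := by simpa using hK 0
  have hH : 0 ≤ H := (norm_nonneg _).trans hκ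
  have hd0 : 0 ≤ d := (norm_nonneg _).trans hd
  rw [norm_smul, norm_mul, norm_pow, one_sub_mul_resolvent hz]
  gcongr
  refine (norm_add_le _ _).trans ?_
  rw [norm_smul]
  gcongr

theorem norm_smul_one_sub_mul_resolventPoly_le (hK : ∀ n : ℕ, ‖T ^ n‖ ≤ K) {z : ℂ}
    (hz : ‖z‖ < 1) {d H : ℝ} (hd : ‖1 - z‖ ≤ (1 - ‖z‖) + d) {κ : ℂ} (hκ : ‖κ‖ ≤ H) (n : ℕ) :
    ‖(κ * z) • ((1 - T) * resolventPoly T n z)‖ ≤ H * K * (3 + d / (1 - ‖z‖)) := by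
  have hK0 : 0 ≤ K := (norm_nonneg _).trans (hK 0)
  have hH : 0 ≤ H := (norm_nonneg _).trans hκ
  have hs : 0 < 1 - ‖z‖ := by linarith
  rw [norm_smul, norm_mul]
  calc ‖κ‖ * ‖z‖ * ‖(1 - T) * resolventPoly T n z‖
      ≤ H * 1 * (((1 - ‖z‖) + d) * (K / (1 - ‖z‖)) + 2 * K) := by
        gcongr
        exact (norm_one_sub_mul_resolventPoly_le hK n hz).trans (by gcongr)
    _ = H * K * (3 + d / (1 - ‖z‖)) := by
        field_simp
        ring

variable [CompleteSpace A]

theorem norm_smul_pow_mul_one_sub_mul_resolvent_le (hK : ∀ n : ℕ, ‖T ^ n‖ ≤ K) {z : ℂ}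
    (hz : 1 < ‖z‖) (hz3 : ‖z‖ ≤ 3) {d H : ℝ} (hd : ‖1 - z‖ ≤ (‖z‖ - 1) + d) {κ : ℂ}
    (hκ : ‖κ‖ ≤ H) (n : ℕ) :
    ‖(κ * z) • (T ^ n * ((1 - T) * resolvent T z))‖ ≤ 3 * H * K ^ 2 * (2 + d / (‖z‖ - 1)) := by
  have hK0 : 0 ≤ K := (norm_nonneg _).trans (hK 0)
  have hH : 0 ≤ H := (norm_nonneg _).trans hκ
  have hs : 0 < ‖z‖ - 1 := by linarith
  obtain ⟨hres, hb⟩ := resolvent_bound_of_one_lt hK hz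
  have h1 : ‖(1 : A)‖ ≤ K := by simpa using hK 0
  rw [norm_smul, norm_mul, one_sub_mul_resolvent hres]
  calc ‖κ‖ * ‖z‖ * ‖T ^ n * (1 + (1 - z) • resolvent T z)‖
      ≤ H * 3 * (K * (K + ((‖z‖ - 1) + d) * (K / (‖z‖ - 1)))) := by
        gcongr
        refine (norm_mul_le _ _).trans ?_
        gcongr
        · exact hK n
        refine (norm_add_le _ _).trans ?_
        rw [norm_smul]
        gcongr
        exact (norm_nonneg _).trans hd
    _ = _ := by
        field_simp
        ring

end ContourEstimates

/-! ### The integrands and the polynomial part -/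

section Integrands

variable {A : Type*} [NormedRing A] [NormedAlgebra ℂ A] {T : A} {K ε : ℝ}

/-- The integrand representing `Tⁿ (1 - T)` on circles outside the unit disc. -/
noncomputable def tailIntegrand (T : A) (ε : ℝ) (n : ℕ) (z : ℂ) : A :=
  (arcKernel ε z * z) • (T ^ n * ((1 - T) * resolvent T z))

/-- The part of `tailIntegrand` that decays inside the unit disc. -/
noncomputable def mainIntegrand (T : A) (ε : ℝ) (n : ℕ) (z : ℂ) : A :=
  (arcKernel ε z * z ^ (n + 1)) • ((1 - T) * resolvent T z)

/-- The part of `tailIntegrand` without singularities on the spectrum of `T`. -/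
noncomputable def polyIntegrand (T : A) (ε : ℝ) (n : ℕ) (z : ℂ) : A :=
  (arcKernel ε z * z) • ((1 - T) * resolventPoly T n z)

theorem tailIntegrand_eq {z : ℂ} (hz : z ∈ resolventSet ℂ T) (n : ℕ) :
    tailIntegrand T ε n z = mainIntegrand T ε n z - polyIntegrand T ε n z := by
  rw [tailIntegrand, pow_mul_one_sub_mul_resolvent hz, smul_sub, smul_smul, mainIntegrand,
    polyIntegrand, mul_assoc, ← pow_succ']

theorem differentiableAt_polyIntegrand {z : ℂ} (hz : z ≠ Real.exp (-ε)) (n : ℕ) :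
    DifferentiableAt ℂ (polyIntegrand T ε n) z := by
  have h1 := differentiableAt_arcKernel hz
  have h2 := (differentiable_resolventPoly T n) z
  unfold polyIntegrand
  fun_prop

/-- The polynomial part is pushed inside the unit disc. There its integral over a full circle is
zero, so that it suffices to estimate it on the short arc near `1`. -/
theorem norm_integral_polyIntegrand_le [CompleteSpace A] (hK : ∀ n : ℕ, ‖T ^ n‖ ≤ K)
    (hε : 0 < ε) (hε1 : ε ≤ 1) (n : ℕ) :
    ‖∫ x in ε..2 * Real.pi - ε,
      polyIntegrand T ε n (Complex.exp (Complex.I * (x + (0 : ℝ) * Complex.I)))‖ ≤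
        9880 * K * ε := by
  have hπ := Real.pi_gt_three
  have hK0 : 0 ≤ K := (norm_nonneg _).trans (hK 0)
  have hside : ∀ x : ℝ, (x = ε ∨ x = 2 * Real.pi - ε) →
      ‖∫ y in (0 : ℝ)..2 * ε,
        polyIntegrand T ε n (Complex.exp (Complex.I * (x + y * Complex.I)))‖ ≤ 2940 * K * ε := by
    intro x hx
    refine (intervalIntegral.norm_integral_le_of_norm_le_const (C := 1470 * K) ?_).trans ?_
    · intro y hy
      rw [uIoc_of_le (by linarith)] at hy
      obtain ⟨h1, h2⟩ := norm_arcKernel_vertical_le (y := y) hε hε1 hx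
      set z := Complex.exp (Complex.I * (x + y * Complex.I)) with hz
      have hzn : ‖z‖ = Real.exp (-y) := norm_exp_I_mul x y
      have hz1 : ‖z‖ < 1 := by rw [hzn, Real.exp_lt_one_iff]; linarith [hy.1]
      have hsy : 1 - ‖z‖ ≤ 2 * ε := by
        rw [hzn]; linarith [Real.add_one_le_exp (-y), hy.2]
      have hs0 : 0 < 1 - ‖z‖ := by linarith
      have habs : |Real.exp (-y) - 1| = 1 - ‖z‖ := by
        rw [hzn, abs_sub_comm, abs_of_pos (by rw [← hzn]; exact hs0)]
      rw [habs] at h1 h2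
      refine (norm_smul_one_sub_mul_resolventPoly_le hK hz1 h2 h1 n).trans ?_
      have e : 210 * (1 - ‖z‖) / ε * K * (3 + ε / (1 - ‖z‖)) =
          210 * K * (3 * ((1 - ‖z‖) / ε) + 1) := by
        field_simp
      have h3 : (1 - ‖z‖) / ε ≤ 2 := by rw [div_le_iff₀ hε]; exact hsy
      rw [e]
      calc 210 * K * (3 * ((1 - ‖z‖) / ε) + 1) ≤ 210 * K * (3 * 2 + 1) := by gcongr
        _ = _ := by ring
    · rw [sub_zero, abs_of_pos (by linarith)]
      linarith
  have hz_ne : ∀ y : ℝ, 2 * ε ≤ y → ∀ x : ℝ,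
      ε / 10 ≤ ‖Complex.exp (Complex.I * (x + y * Complex.I)) - Real.exp (-ε)‖ := by
    intro y hy x
    have h1 := norm_sub_norm_le ((Real.exp (-ε) : ℝ) : ℂ)
      (Complex.exp (Complex.I * (x + y * Complex.I)))
    rw [norm_exp_I_mul, Complex.norm_real, Real.norm_eq_abs, abs_of_pos (Real.exp_pos _),
      norm_sub_rev] at h1
    refine le_trans ?_ h1
    have h2 : Real.exp (-y) ≤ Real.exp (-(2 * ε)) := Real.exp_le_exp.2 (by linarith)
    have h3 : Real.exp (-ε) = Real.exp (-(2 * ε)) * Real.exp ε := by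
      rw [← Real.exp_add]; ring_nf
    have h4 : 1 / 9 ≤ Real.exp (-(2 * ε)) := by
      have h5 : Real.exp (-2) ≤ Real.exp (-(2 * ε)) := Real.exp_le_exp.2 (by linarith)
      have h6 : Real.exp 2 ≤ 9 := by
        have h7 : Real.exp 2 = Real.exp 1 * Real.exp 1 := by rw [← Real.exp_add]; norm_num
        rw [h7]
        have h8 := Real.exp_one_lt_d9
        nlinarith [Real.exp_pos 1]
      have h9 : 1 / 9 ≤ Real.exp (-2) := by
        rw [Real.exp_neg, one_div]
        exact inv_anti₀ (Real.exp_pos _) h6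
      linarith
    nlinarith [Real.add_one_le_exp ε]
  have hdiff : DifferentiableOn ℂ (fun w : ℂ => polyIntegrand T ε n (Complex.exp (Complex.I * w)))
      (uIcc ε (2 * Real.pi - ε) ×ℂ uIcc 0 (2 * ε)) := by
    intro w hw
    obtain ⟨hw1, -⟩ := hw
    rw [mem_preimage, uIcc_of_le (by linarith)] at hw1
    have hw' : w = (w.re : ℂ) + (w.im : ℂ) * Complex.I := (Complex.re_add_im w).symm
    have hne : Complex.exp (Complex.I * w) ≠ Real.exp (-ε) := by
      have := le_norm_exp_sub_of_cos_le (y := w.im) hε hε1 (exists_reduced_angle hε hw1).1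
      rw [← hw'] at this
      intro h
      rw [h, sub_self, norm_zero] at this
      linarith
    have := differentiableAt_polyIntegrand (T := T) hne n
    exact (DifferentiableAt.comp (f := fun w : ℂ => Complex.exp (Complex.I * w)) w this
      (by fun_prop)).differentiableWithinAt
  have hcirc : DifferentiableOn ℂ (polyIntegrand T ε n)
      (Metric.closedBall 0 (Real.exp (-(2 * ε)))) := by
    intro z hz
    refine (differentiableAt_polyIntegrand ?_ n).differentiableWithinAt
    rintro rfl
    rw [mem_closedBall_zero_iff, Complex.norm_real, Real.norm_eq_abs,
      abs_of_pos (Real.exp_pos _), Real.exp_le_exp] at hz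
    linarith
  have htot := integral_exp_I_mul_eq (-ε) hcirc
  have hcont : Continuous fun x : ℝ =>
      polyIntegrand T ε n (Complex.exp (Complex.I * (x + (2 * ε : ℝ) * Complex.I))) := by
    rw [continuous_iff_continuousAt]
    intro x
    have hne : Complex.exp (Complex.I * (x + (2 * ε : ℝ) * Complex.I)) ≠ Real.exp (-ε) := by
      have := hz_ne (2 * ε) le_rfl x
      intro h
      rw [h, sub_self, norm_zero] at this
      linarith
    have := (differentiableAt_polyIntegrand (T := T) hne n).continuousAt
    exact ContinuousAt.comp (f := fun x : ℝ =>
      Complex.exp (Complex.I * (x + (2 * ε : ℝ) * Complex.I))) this (by fun_prop)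
  have htop : ‖∫ x in ε..2 * Real.pi - ε,
      polyIntegrand T ε n (Complex.exp (Complex.I * (x + (2 * ε : ℝ) * Complex.I)))‖ ≤
        4000 * K * ε := by
    rw [show -ε + 2 * Real.pi = 2 * Real.pi - ε by ring,
      ← intervalIntegral.integral_add_adjacent_intervals
      (hcont.intervalIntegrable (-ε) ε) (hcont.intervalIntegrable ε (2 * Real.pi - ε))] at htot
    have h0 : polyIntegrand T ε n 0 = 0 := by simp [polyIntegrand]
    rw [h0, smul_zero, add_eq_zero_iff_neg_eq] at htot
    rw [← htot, norm_neg]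
    refine (intervalIntegral.norm_integral_le_of_norm_le_const (C := 2000 * K) ?_).trans ?_
    · intro x hx
      rw [uIoc_of_le (by linarith)] at hx
      have hx1 : ‖Complex.exp (Complex.I * x) - 1‖ ≤ ε :=
        Real.norm_exp_I_mul_ofReal_sub_one_le.trans (abs_le.2 ⟨hx.1.le, hx.2⟩)
      have h2 := norm_one_sub_exp_I_mul_le (y := 2 * ε) hx1
      have h1 := norm_arcKernel_le hε (hz_ne (2 * ε) le_rfl x)
      set z := Complex.exp (Complex.I * (x + (2 * ε : ℝ) * Complex.I)) with hz
      have hzn : ‖z‖ = Real.exp (-(2 * ε)) := norm_exp_I_mul x (2 * ε)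
      have hz1 : ‖z‖ < 1 := by rw [hzn, Real.exp_lt_one_iff]; linarith
      have hs0 : 0 < 1 - ‖z‖ := by linarith
      have habs : |Real.exp (-(2 * ε)) - 1| = 1 - ‖z‖ := by
        rw [hzn, abs_sub_comm, abs_of_pos (by rw [← hzn]; exact hs0)]
      rw [habs] at h2
      refine (norm_smul_one_sub_mul_resolventPoly_le hK hz1 h2 h1 n).trans ?_
      have h3 : ε / (1 - ‖z‖) ≤ 3 / 2 := by
        rw [div_le_iff₀ hs0, hzn, Real.exp_neg]
        have h4 : (Real.exp (2 * ε))⁻¹ ≤ (1 + 2 * ε)⁻¹ :=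
          inv_anti₀ (by linarith) (by linarith [Real.add_one_le_exp (2 * ε)])
        have h5 : (1 + 2 * ε)⁻¹ ≤ 1 - 2 / 3 * ε := by
          rw [inv_le_iff_one_le_mul₀ (by linarith)]
          nlinarith
        linarith
      calc 441 * K * (3 + ε / (1 - ‖z‖)) ≤ 441 * K * (3 + 3 / 2) := by gcongr
        _ ≤ _ := by linarith
    · rw [abs_of_pos (by linarith)]
      linarith
  have := norm_integral_horizontal_le hdiff htop (hside _ (Or.inl rfl)) (hside _ (Or.inr rfl))
  linarith

end Integrands

/-! ### The decaying part -/

section MainPart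

variable {A : Type*} [NormedRing A] [NormedAlgebra ℂ A] [CompleteSpace A] {T : A} {K ε : ℝ}

theorem differentiableAt_mainIntegrand {z : ℂ} (hz : z ≠ Real.exp (-ε))
    (hz' : z ∈ resolventSet ℂ T) (n : ℕ) : DifferentiableAt ℂ (mainIntegrand T ε n) z := by
  have h1 := differentiableAt_arcKernel hz
  have h2 := differentiableAt_resolvent hz'
  unfold mainIntegrand
  fun_prop

theorem differentiableAt_tailIntegrand {z : ℂ} (hz : z ≠ Real.exp (-ε))
    (hz' : z ∈ resolventSet ℂ T) (n : ℕ) : DifferentiableAt ℂ (tailIntegrand T ε n) z := by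
  have h1 := differentiableAt_arcKernel hz
  have h2 := differentiableAt_resolvent hz'
  unfold tailIntegrand
  fun_prop

theorem integral_exp_neg_mul_le {n : ℕ} (hn : 1 ≤ n) {η : ℝ} :
    ∫ y in (0 : ℝ)..η, Real.exp (-(n * y)) ≤ 1 / n := by
  have hn0 : (0 : ℝ) < n := by exact_mod_cast hn
  have hd : ∀ y ∈ uIcc 0 η, HasDerivAt (fun y : ℝ => -(Real.exp (-(n * y)) / n))
      (Real.exp (-(n * y))) y := by
    intro y _
    have h := ((((hasDerivAt_id y).const_mul (n : ℝ)).neg.exp).div_const (n : ℝ)).neg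
    convert! h using 1
    simp only [id]
    field_simp
    rfl
  rw [intervalIntegral.integral_eq_sub_of_hasDerivAt hd
    ((by fun_prop : Continuous fun y : ℝ => Real.exp (-(n * y))).intervalIntegrable _ _)]
  have : 0 ≤ Real.exp (-(n * η)) / n := by positivity
  simp only [mul_zero, neg_zero, Real.exp_zero]
  linarith

/-- The decaying part, pushed inside the unit disc to depth `c / M`, where the Neumann series still
controls the resolvent. -/
theorem norm_integral_mainIntegrand_le (hK : ∀ n : ℕ, ‖T ^ n‖ ≤ K) (hε : 0 < ε) (hε1 : ε ≤ 1)
    {c M : ℝ} (hc0 : 0 < c) (hc : c < 1) (hM : 0 < M)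
    (hR : ∀ θ : ℝ, ε ≤ |θ| → |θ| ≤ Real.pi → Complex.exp (Complex.I * θ) ∈ resolventSet ℂ T ∧
      ‖resolvent T (Complex.exp (Complex.I * θ))‖ ≤ M) {n : ℕ} (hn : 1 ≤ n) :
    ‖∫ x in ε..2 * Real.pi - ε,
      mainIntegrand T ε n (Complex.exp (Complex.I * (x + (0 : ℝ) * Complex.I)))‖ ≤
        441 * (K + 1 / (1 - c)) *
          (14 * ((1 + M) * Real.exp (-(n * (c / M)))) + 2 * ((1 + ε * M) / n)) := by
  have hπ := Real.pi_gt_three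
  have hK0 : 0 ≤ K := (norm_nonneg _).trans (hK 0)
  have hc' : 0 < 1 - c := by linarith
  set η := c / M with hη
  have hη0 : 0 < η := by positivity
  have hηM : η * M = c := by rw [hη]; field_simp
  set q := 1 / (1 - c) with hq
  have hq0 : 0 < q := by positivity
  have hres : ∀ x ∈ Icc ε (2 * Real.pi - ε), ∀ y ∈ Icc 0 η,
      Complex.exp (Complex.I * (x + y * Complex.I)) ∈ resolventSet ℂ T ∧
        ‖resolvent T (Complex.exp (Complex.I * (x + y * Complex.I)))‖ ≤ M * q := by
    intro x hx y hy
    obtain ⟨-, θ, h1, h2, h3⟩ := exists_reduced_angle hε hx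
    obtain ⟨h4, h5⟩ := hR θ h1 h2
    rw [← h3] at h4 h5
    have h6 := norm_exp_I_mul_sub x y
    have h7 : |Real.exp (-y) - 1| ≤ η := by
      rw [abs_le]
      constructor
      · linarith [Real.add_one_le_exp (-y), hy.2]
      · linarith [Real.exp_le_one_iff.2 (neg_nonpos.2 hy.1)]
    obtain ⟨h8, h9⟩ := resolvent_bound_of_near h4 hc
      (w := Complex.exp (Complex.I * (x + y * Complex.I))) (by
        rw [h6, ← hηM]
        gcongr)
    refine ⟨h8, h9.trans ?_⟩
    rw [hq, mul_one_div]
    gcongr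
  have hlow : ∀ x ∈ Icc ε (2 * Real.pi - ε), ∀ y : ℝ,
      ε / 10 ≤ ‖Complex.exp (Complex.I * (x + y * Complex.I)) - Real.exp (-ε)‖ := fun x hx y =>
    le_norm_exp_sub_of_cos_le hε hε1 (exists_reduced_angle hε hx).1
  have hpow : ∀ x y : ℝ, 0 ≤ y →
      ‖Complex.exp (Complex.I * (x + y * Complex.I))‖ ^ (n + 1) ≤ Real.exp (-(n * y)) := by
    intro x y hy
    rw [norm_exp_I_mul, ← Real.exp_nat_mul, Real.exp_le_exp]
    push_cast
    linarith
  have hside : ∀ x : ℝ, (x = ε ∨ x = 2 * Real.pi - ε) →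
      ‖∫ y in (0 : ℝ)..η,
        mainIntegrand T ε n (Complex.exp (Complex.I * (x + y * Complex.I)))‖ ≤
          441 * (K + q) * ((1 + ε * M) / n) := by
    intro x hx
    have hmem : x ∈ Icc ε (2 * Real.pi - ε) := by
      rcases hx with rfl | rfl <;> constructor <;> linarith
    have hb : ∀ y ∈ Ioc 0 η,
        ‖mainIntegrand T ε n (Complex.exp (Complex.I * (x + y * Complex.I)))‖ ≤
          441 * (K + q) * (1 + ε * M) * Real.exp (-(n * y)) := by
      intro y hy
      obtain ⟨h1, h2⟩ := hres x hmem y ⟨hy.1.le, hy.2⟩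
      have h3 := (norm_arcKernel_vertical_le (y := y) hε hε1 hx).2
      have h4 : |Real.exp (-y) - 1| ≤ η := by
        rw [abs_le]
        constructor
        · linarith [Real.add_one_le_exp (-y), hy.2]
        · linarith [Real.exp_le_one_iff.2 (neg_nonpos.2 hy.1.le)]
      refine (norm_smul_one_sub_mul_resolvent_le hK h1 h2 (h3.trans (add_le_add_left h4 ε))
        (norm_arcKernel_le hε (hlow x hmem y)) n).trans ?_
      have h5 : K + (η + ε) * (M * q) ≤ (K + q) * (1 + ε * M) := by
        have e : K + (η + ε) * (M * q) = K + (c + ε * M) * q := by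
          rw [← hηM]; ring
        have h6 : 0 ≤ K * (ε * M) := by positivity
        have h7 : c * q ≤ 1 * q := by gcongr
        rw [e]
        linarith
      calc _ ≤ 441 * Real.exp (-(n * y)) * ((K + q) * (1 + ε * M)) := by
            gcongr
            exact hpow x y hy.1.le
        _ = _ := by ring
    have hint : IntervalIntegrable
        (fun y : ℝ => 441 * (K + q) * (1 + ε * M) * Real.exp (-(n * y))) MeasureTheory.volume
          0 η := (by fun_prop : Continuous fun y : ℝ =>
            441 * (K + q) * (1 + ε * M) * Real.exp (-(n * y))).intervalIntegrable _ _
    refine (intervalIntegral.norm_integral_le_of_norm_le hη0.le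
      (MeasureTheory.ae_of_all _ hb) hint).trans ?_
    rw [intervalIntegral.integral_const_mul]
    calc _ ≤ 441 * (K + q) * (1 + ε * M) * (1 / n) := by
          gcongr
          exact integral_exp_neg_mul_le hn
      _ = _ := by ring
  have htop : ‖∫ x in ε..2 * Real.pi - ε,
      mainIntegrand T ε n (Complex.exp (Complex.I * (x + (η : ℝ) * Complex.I)))‖ ≤
        441 * (K + q) * (14 * ((1 + M) * Real.exp (-(n * η)))) := by
    refine (intervalIntegral.norm_integral_le_of_norm_le_const
      (C := 441 * (K + q) * (2 * ((1 + M) * Real.exp (-(n * η))))) ?_).trans ?_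
    · intro x hx
      rw [uIoc_of_le (by linarith)] at hx
      have hmem : x ∈ Icc ε (2 * Real.pi - ε) := ⟨hx.1.le, hx.2⟩
      obtain ⟨h1, h2⟩ := hres x hmem η ⟨hη0.le, le_rfl⟩
      have h3 : ‖1 - Complex.exp (Complex.I * (x + η * Complex.I))‖ ≤ 2 := by
        refine (norm_sub_le _ _).trans ?_
        rw [norm_one, norm_exp_I_mul]
        linarith [Real.exp_le_one_iff.2 (neg_nonpos.2 hη0.le)]
      refine (norm_smul_one_sub_mul_resolvent_le hK h1 h2 h3
        (norm_arcKernel_le hε (hlow x hmem η)) n).trans ?_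
      have h5 : K + 2 * (M * q) ≤ (K + q) * (2 * (1 + M)) := by
        have : 0 ≤ K * M := by positivity
        linarith
      calc _ ≤ 441 * Real.exp (-(n * η)) * ((K + q) * (2 * (1 + M))) := by
            gcongr
            exact hpow x η hη0.le
        _ = _ := by ring
    · have h7 : |2 * Real.pi - ε - ε| ≤ 7 := by
        rw [abs_of_pos (by linarith)]
        linarith [Real.pi_lt_d2]
      calc _ ≤ 441 * (K + q) * (2 * ((1 + M) * Real.exp (-(n * η)))) * 7 := by gcongr
        _ = _ := by ring
  have hdiff : DifferentiableOn ℂ (fun w : ℂ => mainIntegrand T ε n (Complex.exp (Complex.I * w)))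
      (uIcc ε (2 * Real.pi - ε) ×ℂ uIcc 0 η) := by
    intro w hw
    obtain ⟨hw1, hw2⟩ := hw
    rw [mem_preimage, uIcc_of_le (by linarith)] at hw1
    rw [mem_preimage, uIcc_of_le hη0.le] at hw2
    have hw' : w = (w.re : ℂ) + (w.im : ℂ) * Complex.I := (Complex.re_add_im w).symm
    have h1 := (hres _ hw1 _ hw2).1
    have h2 := hlow _ hw1 w.im
    rw [← hw'] at h1 h2
    have hne : Complex.exp (Complex.I * w) ≠ Real.exp (-ε) := by
      intro h
      rw [h, sub_self, norm_zero] at h2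
      linarith
    exact (DifferentiableAt.comp (f := fun w : ℂ => Complex.exp (Complex.I * w)) w
      (differentiableAt_mainIntegrand hne h1 n) (by fun_prop)).differentiableWithinAt
  refine (norm_integral_horizontal_le hdiff htop (hside _ (Or.inl rfl))
    (hside _ (Or.inr rfl))).trans (le_of_eq ?_)
  ring

end MainPart

/-! ### The tail and the combined estimate -/

section TailPart

variable {A : Type*} [NormedRing A] [NormedAlgebra ℂ A] [CompleteSpace A] {T : A} {K ε : ℝ}

/-- Integrating the tail over a circle outside the unit disc recovers `Tⁿ (1 - T)`: the kernel
is `1` at infinity. -/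
theorem integral_tailIntegrand (hK : ∀ n : ℕ, ‖T ^ n‖ ≤ K) (hε : 0 < ε) (n : ℕ) :
    ∫ x in -ε..-ε + 2 * Real.pi,
      tailIntegrand T ε n (Complex.exp (Complex.I * (x + (-ε : ℝ) * Complex.I))) =
        (2 * Real.pi) • (T ^ n * (1 - T)) := by
  set F : ℂ → A := fun w => ((1 - w * Complex.exp (Complex.I * ε)) *
    (1 - w * Complex.exp (-(Complex.I * ε))) / (1 - w * Real.exp (-ε)) ^ 2) •
      (T ^ n * ((1 - T) * Ring.inverse (1 - w • T))) with hF
  have hr : Real.exp (-ε) < 1 := by rw [Real.exp_lt_one_iff]; linarith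
  have hd : DifferentiableOn ℂ F (Metric.closedBall 0 (Real.exp (-ε))) := by
    have h1 := differentiableOn_inverse_one_sub_smul_of_powerBounded hK hr
    have h2 : ∀ w ∈ Metric.closedBall (0 : ℂ) (Real.exp (-ε)),
        (1 - w * Real.exp (-ε)) ^ 2 ≠ 0 := by
      intro w hw
      rw [mem_closedBall_zero_iff] at hw
      refine pow_ne_zero _ fun h => ?_
      have h3 : ‖w * Real.exp (-ε)‖ = 1 := by rw [← sub_eq_zero.1 h, norm_one]
      rw [norm_mul, Complex.norm_real, Real.norm_eq_abs, abs_of_pos (Real.exp_pos _)] at h3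
      have := Real.exp_pos (-ε)
      nlinarith
    have h4 : DifferentiableOn ℂ (fun w : ℂ => (1 - w * Complex.exp (Complex.I * ε)) *
        (1 - w * Complex.exp (-(Complex.I * ε))) / (1 - w * Real.exp (-ε)) ^ 2)
        (Metric.closedBall 0 (Real.exp (-ε))) :=
      DifferentiableOn.div (by fun_prop) (by fun_prop) h2
    exact h4.smul ((h1.const_mul (1 - T)).const_mul (T ^ n))
  have h := integral_exp_I_mul_inv_eq (-ε) hd
  have h0 : F 0 = T ^ n * (1 - T) := by simp [hF]
  rw [h0] at h
  rw [← h]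
  refine intervalIntegral.integral_congr fun x _ => ?_
  have hz : Complex.exp (Complex.I * (x + (-ε : ℝ) * Complex.I)) ≠ 0 := Complex.exp_ne_zero _
  generalize Complex.exp (Complex.I * (x + (-ε : ℝ) * Complex.I)) = z at hz ⊢
  simp only [hF, tailIntegrand, inverse_one_sub_inv_smul hz]
  rw [mul_smul_comm, mul_smul_comm, smul_smul]
  congr 2
  have e : ∀ u : ℂ, 1 - z⁻¹ * u = z⁻¹ * (z - u) := fun u => by
    rw [mul_sub, inv_mul_cancel₀ hz]
  rw [arcKernel, e, e, e, mul_pow, mul_mul_mul_comm, ← sq, mul_div_mul_left _ _ (by positivity)]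

/-- The contribution of the arc near `1`, which lies outside the unit disc. -/
theorem norm_integral_tailIntegrand_arc_le (hK : ∀ n : ℕ, ‖T ^ n‖ ≤ K) (hε : 0 < ε)
    (hε1 : ε ≤ 1) (n : ℕ) :
    ‖∫ x in -ε..ε,
      tailIntegrand T ε n (Complex.exp (Complex.I * (x + (-ε : ℝ) * Complex.I)))‖ ≤
        7938 * K ^ 2 * ε := by
  refine (intervalIntegral.norm_integral_le_of_norm_le_const (C := 3969 * K ^ 2) ?_).trans ?_
  · intro x hx
    rw [uIoc_of_le (by linarith)] at hx
    have hx1 : ‖Complex.exp (Complex.I * x) - 1‖ ≤ ε :=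
      Real.norm_exp_I_mul_ofReal_sub_one_le.trans (abs_le.2 ⟨hx.1.le, hx.2⟩)
    have h2 := norm_one_sub_exp_I_mul_le (y := -ε) hx1
    have hlow : ε / 10 ≤
        ‖Complex.exp (Complex.I * (x + (-ε : ℝ) * Complex.I)) - Real.exp (-ε)‖ := by
      have h1 := norm_sub_norm_le (Complex.exp (Complex.I * (x + (-ε : ℝ) * Complex.I)))
        ((Real.exp (-ε) : ℝ) : ℂ)
      rw [norm_exp_I_mul, neg_neg, Complex.norm_real, Real.norm_eq_abs,
        abs_of_pos (Real.exp_pos _)] at h1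
      linarith [Real.add_one_le_exp ε, Real.exp_le_one_iff.2 (neg_nonpos.2 hε.le)]
    have h1 := norm_arcKernel_le hε hlow
    set z := Complex.exp (Complex.I * (x + (-ε : ℝ) * Complex.I)) with hz
    have hzn : ‖z‖ = Real.exp ε := by rw [hz, norm_exp_I_mul, neg_neg]
    have hs : ε ≤ ‖z‖ - 1 := by rw [hzn]; linarith [Real.add_one_le_exp ε]
    have hz3 : ‖z‖ ≤ 3 := by
      rw [hzn]
      linarith [Real.exp_le_exp.2 hε1, Real.exp_one_lt_d9]
    rw [neg_neg, ← hzn, abs_of_pos (by linarith)] at h2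
    refine (norm_smul_pow_mul_one_sub_mul_resolvent_le hK (by linarith) hz3 h2 h1 n).trans ?_
    have h3 : ε / (‖z‖ - 1) ≤ 1 := by rw [div_le_one (by linarith)]; exact hs
    calc 3 * 441 * K ^ 2 * (2 + ε / (‖z‖ - 1)) ≤ 3 * 441 * K ^ 2 * (2 + 1) := by gcongr
      _ = _ := by ring
  · rw [abs_of_pos (by linarith)]
    linarith

/-- On the vertical sides the zero of the kernel compensates the blow-up of the resolvent. -/
theorem norm_integral_tailIntegrand_side_le (hK : ∀ n : ℕ, ‖T ^ n‖ ≤ K) (hε : 0 < ε)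
    (hε1 : ε ≤ 1) (n : ℕ) {x : ℝ} (hx : x = ε ∨ x = 2 * Real.pi - ε) :
    ‖∫ y in -ε..0, tailIntegrand T ε n (Complex.exp (Complex.I * (x + y * Complex.I)))‖ ≤
        3150 * K ^ 2 * ε := by
  refine (intervalIntegral.norm_integral_le_of_norm_le_const (C := 3150 * K ^ 2) ?_).trans ?_
  · intro y hy
    rw [uIoc_of_le (by linarith)] at hy
    obtain ⟨h1, h2⟩ := norm_arcKernel_vertical_le (y := y) hε hε1 hx
    set z := Complex.exp (Complex.I * (x + y * Complex.I)) with hz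
    have hzn : ‖z‖ = Real.exp (-y) := norm_exp_I_mul x y
    rcases hy.2.eq_or_lt with hy0 | hy0
    · -- at the corner the kernel vanishes, whatever the value of the resolvent there
      have h3 : arcKernel ε z = 0 := by
        rw [hy0] at h1
        simpa using h1
      rw [tailIntegrand, h3, zero_mul, zero_smul, norm_zero]
      positivity
    have hs0 : 0 < ‖z‖ - 1 := by rw [hzn]; linarith [Real.add_one_le_exp (-y)]
    have hs : ‖z‖ - 1 ≤ 2 * ε := by
      have h4 := Real.abs_exp_sub_one_le (x := ε) (by rwa [abs_of_pos hε])
      rw [abs_of_pos hε] at h4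
      have h5 : Real.exp (-y) ≤ Real.exp ε := Real.exp_le_exp.2 (by linarith [hy.1])
      rw [hzn]
      linarith [le_abs_self (Real.exp ε - 1)]
    rw [← hzn, abs_of_pos hs0] at h1 h2
    refine (norm_smul_pow_mul_one_sub_mul_resolvent_le hK (by linarith) (by linarith) h2 h1
      n).trans ?_
    have e : 3 * (210 * (‖z‖ - 1) / ε) * K ^ 2 * (2 + ε / (‖z‖ - 1)) =
        630 * K ^ 2 * (2 * ((‖z‖ - 1) / ε) + 1) := by
      field_simp
      ring
    have h3 : (‖z‖ - 1) / ε ≤ 2 := by rw [div_le_iff₀ hε]; exact hs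
    rw [e]
    calc 630 * K ^ 2 * (2 * ((‖z‖ - 1) / ε) + 1) ≤ 630 * K ^ 2 * (2 * 2 + 1) := by gcongr
      _ = _ := by ring
  · rw [sub_neg_eq_add, zero_add, abs_of_pos hε]

/-- A non-asymptotic bound of `Tⁿ (1 - T)` that uses the resolvent on the unit circle only at angles
of absolute value at least `ε`. The constant depends on `K` and `c` alone. -/
theorem norm_pow_mul_one_sub_le (hK : ∀ n : ℕ, ‖T ^ n‖ ≤ K) {c : ℝ} (hc0 : 0 < c) (hc : c < 1) :
    ∃ C : ℝ, 0 ≤ C ∧ ∀ ε : ℝ, 0 < ε → ε ≤ 1 → ∀ M : ℝ, 0 < M →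
      (∀ θ : ℝ, ε ≤ |θ| → |θ| ≤ Real.pi → Complex.exp (Complex.I * θ) ∈ resolventSet ℂ T ∧
        ‖resolvent T (Complex.exp (Complex.I * θ))‖ ≤ M) →
      ∀ n : ℕ, 1 ≤ n → ‖T ^ n * (1 - T)‖ ≤
        C * (ε + (1 + M) * Real.exp (-(n * (c / M))) + (1 + ε * M) / n) := by
  have hK0 : 0 ≤ K := (norm_nonneg _).trans (hK 0)
  have hc' : 0 < 1 - c := by linarith
  set D := 441 * (K + 1 / (1 - c)) with hD
  have hD0 : 0 ≤ D := by positivity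
  refine ⟨14238 * K ^ 2 + 9880 * K + 14 * D, by positivity, ?_⟩
  intro ε hε hε1 M hM hR n hn
  have hπ := Real.pi_gt_three
  set t : ℂ → A := fun w => tailIntegrand T ε n (Complex.exp (Complex.I * w)) with ht
  have hlow : ∀ x ∈ Icc ε (2 * Real.pi - ε), ∀ y : ℝ,
      Complex.exp (Complex.I * (x + y * Complex.I)) ≠ Real.exp (-ε) := by
    intro x hx y h
    have := le_norm_exp_sub_of_cos_le (y := y) hε hε1 (exists_reduced_angle hε hx).1
    rw [h, sub_self, norm_zero] at this
    linarith
  have hcirc : ∀ x ∈ Icc ε (2 * Real.pi - ε),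
      Complex.exp (Complex.I * (x + (0 : ℝ) * Complex.I)) ∈ resolventSet ℂ T := by
    intro x hx
    obtain ⟨-, θ, h1, h2, h3⟩ := exists_reduced_angle hε hx
    rw [Complex.ofReal_zero, zero_mul, add_zero, h3]
    exact (hR θ h1 h2).1
  have hout : ∀ x y : ℝ, y < 0 →
      Complex.exp (Complex.I * (x + y * Complex.I)) ∈ resolventSet ℂ T := by
    intro x y hy
    refine (resolvent_bound_of_one_lt hK ?_).1
    rw [norm_exp_I_mul, Real.one_lt_exp_iff]
    linarith
  have hexp : ∀ w : ℂ, DifferentiableAt ℂ (fun w : ℂ => Complex.exp (Complex.I * w)) w :=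
    fun w => by fun_prop
  have hdiff : DifferentiableOn ℂ t (uIcc ε (2 * Real.pi - ε) ×ℂ uIcc (-ε) 0) := by
    intro w hw
    obtain ⟨hw1, hw2⟩ := hw
    rw [mem_preimage, uIcc_of_le (by linarith)] at hw1
    rw [mem_preimage, uIcc_of_le (by linarith)] at hw2
    have hw' : w = (w.re : ℂ) + (w.im : ℂ) * Complex.I := (Complex.re_add_im w).symm
    have h2 := hlow _ hw1 w.im
    have h1 : Complex.exp (Complex.I * (w.re + w.im * Complex.I)) ∈ resolventSet ℂ T := by
      rcases hw2.2.eq_or_lt with h | h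
      · rw [h]; exact hcirc _ hw1
      · exact hout _ _ h
    rw [← hw'] at h1 h2
    exact (DifferentiableAt.comp (f := fun w : ℂ => Complex.exp (Complex.I * w)) w
      (differentiableAt_tailIntegrand h2 h1 n) (hexp w)).differentiableWithinAt
  have hbase : ‖∫ x in ε..2 * Real.pi - ε, t (x + (0 : ℝ) * Complex.I)‖ ≤
      D * (14 * ((1 + M) * Real.exp (-(n * (c / M)))) + 2 * ((1 + ε * M) / n)) +
        9880 * K * ε := by
    have hline : Continuous fun x : ℝ => Complex.exp (Complex.I * (x + (0 : ℝ) * Complex.I)) := by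
      fun_prop
    have hle : ε ≤ 2 * Real.pi - ε := by linarith
    have i1 : IntervalIntegrable (fun x : ℝ => mainIntegrand T ε n
        (Complex.exp (Complex.I * (x + (0 : ℝ) * Complex.I)))) MeasureTheory.volume
          ε (2 * Real.pi - ε) := by
      refine ContinuousOn.intervalIntegrable fun x hx => ?_
      rw [uIcc_of_le hle] at hx
      exact (ContinuousAt.comp (f := fun x : ℝ =>
        Complex.exp (Complex.I * (x + (0 : ℝ) * Complex.I)))
        (differentiableAt_mainIntegrand (hlow x hx 0) (hcirc x hx) n).continuousAt
          hline.continuousAt).continuousWithinAt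
    have i2 : IntervalIntegrable (fun x : ℝ => polyIntegrand T ε n
        (Complex.exp (Complex.I * (x + (0 : ℝ) * Complex.I)))) MeasureTheory.volume
          ε (2 * Real.pi - ε) := by
      refine ContinuousOn.intervalIntegrable fun x hx => ?_
      rw [uIcc_of_le hle] at hx
      exact (ContinuousAt.comp (f := fun x : ℝ =>
        Complex.exp (Complex.I * (x + (0 : ℝ) * Complex.I)))
        (differentiableAt_polyIntegrand (T := T) (hlow x hx 0) n).continuousAt
          hline.continuousAt).continuousWithinAt
    have hsplit : ∫ x in ε..2 * Real.pi - ε, t (x + (0 : ℝ) * Complex.I) =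
        (∫ x in ε..2 * Real.pi - ε, mainIntegrand T ε n
          (Complex.exp (Complex.I * (x + (0 : ℝ) * Complex.I)))) -
        ∫ x in ε..2 * Real.pi - ε, polyIntegrand T ε n
          (Complex.exp (Complex.I * (x + (0 : ℝ) * Complex.I))) := by
      rw [← intervalIntegral.integral_sub i1 i2]
      refine intervalIntegral.integral_congr fun x hx => ?_
      rw [uIcc_of_le hle] at hx
      exact tailIntegrand_eq (hcirc x hx) n
    rw [hsplit]
    exact (norm_sub_le _ _).trans (add_le_add
      (norm_integral_mainIntegrand_le hK hε hε1 hc0 hc hM hR hn)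
      (norm_integral_polyIntegrand_le hK hε hε1 n))
  have hfar := norm_integral_horizontal_le hdiff hbase
    (norm_integral_tailIntegrand_side_le hK hε hε1 n (Or.inl rfl))
    (norm_integral_tailIntegrand_side_le hK hε hε1 n (Or.inr rfl))
  have hnear := norm_integral_tailIntegrand_arc_le hK hε hε1 n
  have hcont : Continuous fun x : ℝ => t (x + (-ε : ℝ) * Complex.I) := by
    rw [continuous_iff_continuousAt]
    intro x
    have hz := hout x (-ε) (by linarith)
    have hne : Complex.exp (Complex.I * (x + (-ε : ℝ) * Complex.I)) ≠ Real.exp (-ε) := by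
      intro h
      have h2 := norm_exp_I_mul x (-ε)
      rw [h, Complex.norm_real, Real.norm_eq_abs, abs_of_pos (Real.exp_pos _), Real.exp_eq_exp]
        at h2
      linarith
    exact ContinuousAt.comp (f := fun x : ℝ =>
      Complex.exp (Complex.I * (x + (-ε : ℝ) * Complex.I)))
      (differentiableAt_tailIntegrand hne hz n).continuousAt (by fun_prop)
  have htot := integral_tailIntegrand hK hε n
  rw [show -ε + 2 * Real.pi = 2 * Real.pi - ε by ring,
    ← intervalIntegral.integral_add_adjacent_intervals
    (hcont.intervalIntegrable (-ε) ε) (hcont.intervalIntegrable ε (2 * Real.pi - ε))] at htot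
  have hnorm : 2 * Real.pi * ‖T ^ n * (1 - T)‖ ≤ 7938 * K ^ 2 * ε +
      (D * (14 * ((1 + M) * Real.exp (-(n * (c / M)))) + 2 * ((1 + ε * M) / n)) +
        9880 * K * ε + 3150 * K ^ 2 * ε + 3150 * K ^ 2 * ε) := by
    have h1 : 2 * Real.pi * ‖T ^ n * (1 - T)‖ = ‖(2 * Real.pi) • (T ^ n * (1 - T))‖ := by
      rw [norm_smul, Real.norm_eq_abs, abs_of_pos (by positivity)]
    rw [h1, ← htot]
    exact (norm_add_le _ _).trans (add_le_add hnear hfar)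
  set a := (1 + M) * Real.exp (-(n * (c / M))) with ha
  set b := (1 + ε * M) / (n : ℝ) with hb
  have ha0 : 0 ≤ a := by positivity
  have hb0 : 0 ≤ b := by positivity
  have h2 : ‖T ^ n * (1 - T)‖ ≤ 2 * Real.pi * ‖T ^ n * (1 - T)‖ := by
    nlinarith [norm_nonneg (T ^ n * (1 - T))]
  have p1 : 0 ≤ K ^ 2 * a := by positivity
  have p2 : 0 ≤ K ^ 2 * b := by positivity
  have p3 : 0 ≤ K * a := by positivity
  have p4 : 0 ≤ K * b := by positivity
  have p5 : 0 ≤ D * ε := by positivity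
  have p6 : 0 ≤ D * b := by positivity
  linarith

end TailPart

/-! ### Choice of `ε` -/

section Rate

theorem eventually_mLogInv {m : ℝ → ℝ} (hm_cont : ContinuousOn m (Ioc 0 Real.pi))
    (hm_pos : ∀ ε ∈ Ioc 0 Real.pi, 0 < m ε) (hm_anti : AntitoneOn m (Ioc 0 Real.pi))
    {c : ℝ} (hc : 0 < c) {δ : ℝ} (hδ : δ ∈ Ioc 0 Real.pi) :
    ∀ᶠ n : ℕ in atTop, 0 < mLogInv m Real.pi (c * n) ∧ mLogInv m Real.pi (c * n) ≤ δ ∧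
      mLog m (mLogInv m Real.pi (c * n)) = c * n := by
  have hbij := mLog_bijOn m Real.pi Real.pi_pos hm_cont hm_pos hm_anti
  have hinv := mLogInv_invOn m Real.pi Real.pi_pos hm_cont hm_pos hm_anti
  have hsa := mLog_strictAntiOn m Real.pi hm_pos hm_anti
  have ht : Tendsto (fun n : ℕ => c * (n : ℝ)) atTop atTop :=
    tendsto_natCast_atTop_atTop.const_mul_atTop hc
  filter_upwards [ht.eventually_ge_atTop (mLog m δ)] with n hn
  have hmem : c * (n : ℝ) ∈ Ici (mLog m Real.pi) :=
    (hsa.antitoneOn hδ ⟨Real.pi_pos, le_rfl⟩ hδ.2).trans hn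
  have h1 : mLogInv m Real.pi (c * n) ∈ Ioc 0 Real.pi :=
    Function.invFunOn_mem (hbij.surjOn hmem)
  have h2 : mLog m (mLogInv m Real.pi (c * n)) = c * n := hinv.2 hmem
  refine ⟨h1.1, ?_, h2⟩
  by_contra! h
  have := hsa hδ h1 h
  linarith

theorem exp_neg_log_one_add_div_le {M ε : ℝ} (hM : 0 < M) (hε : 0 < ε) :
    Real.exp (-Real.log (1 + M / ε)) ≤ ε / M := by
  have h : 0 < M / ε := by positivity
  rw [Real.exp_neg, Real.exp_log (by linarith), ← inv_div M ε]
  exact inv_anti₀ h (by linarith)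

theorem exp_I_mul_ne_one {θ : ℝ} (hθ : |θ| ∈ Ioc 0 Real.pi) : Complex.exp (Complex.I * θ) ≠ 1 := by
  intro h
  have h2 := congrArg Complex.re h
  rw [mul_comm, Complex.exp_ofReal_mul_I_re, Complex.one_re, ← Real.cos_abs] at h2
  have h3 := Real.cos_lt_cos_of_nonneg_of_le_pi le_rfl hθ.2 hθ.1
  rw [Real.cos_zero] at h3
  linarith

variable {A : Type*} [NormedRing A] [NormedAlgebra ℂ A] {T : A}

theorem exp_I_mul_mem_resolventSet (hσ : spectrum ℂ T ∩ Metric.sphere (0 : ℂ) 1 ⊆ {1}) {θ : ℝ}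
    (hθ : |θ| ∈ Ioc 0 Real.pi) : Complex.exp (Complex.I * θ) ∈ resolventSet ℂ T := by
  by_contra h
  exact exp_I_mul_ne_one hθ (hσ ⟨h, by simp [Complex.norm_exp_I_mul_ofReal]⟩)

variable [CompleteSpace A] {m : ℝ → ℝ} {c : ℝ}

/-- If `1` is a spectral value then `m(ε) ≥ 1 / ε`, and `ε = m_log⁻¹(c n)` balances the terms of
`norm_pow_mul_one_sub_le`. -/
theorem isBigO_of_one_mem_spectrum {K : ℝ} (hK : ∀ n : ℕ, ‖T ^ n‖ ≤ K)
    (hσ : spectrum ℂ T ∩ Metric.sphere (0 : ℂ) 1 ⊆ {1})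
    (hm_cont : ContinuousOn m (Ioc 0 Real.pi)) (hm_pos : ∀ ε ∈ Ioc 0 Real.pi, 0 < m ε)
    (hm_anti : AntitoneOn m (Ioc 0 Real.pi))
    (hR : ∀ θ : ℝ, |θ| ∈ Ioc 0 Real.pi → ‖resolvent T (Complex.exp (Complex.I * θ))‖ ≤ m |θ|)
    (hc0 : 0 < c) (hc1 : c < 1) (h1 : (1 : ℂ) ∈ spectrum ℂ T) :
    (fun n : ℕ => ‖T ^ n * (1 - T)‖) =O[atTop] (fun n : ℕ => mLogInv m Real.pi (c * n)) := by
  obtain ⟨C, hC0, hC⟩ := norm_pow_mul_one_sub_le hK hc0 hc1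
  have hπ := Real.pi_gt_three
  refine IsBigO.of_bound (C * 7) ?_
  filter_upwards [eventually_mLogInv hm_cont hm_pos hm_anti hc0
    (δ := 1) ⟨one_pos, by linarith⟩, eventually_ge_atTop 1] with n hn hn1
  set ε := mLogInv m Real.pi (c * n)
  obtain ⟨hε, hε1, hmn⟩ := hn
  have hεmem : ε ∈ Ioc 0 Real.pi := ⟨hε, by linarith⟩
  have hn0 : (0 : ℝ) < n := by exact_mod_cast hn1
  have hest := hC ε hε hε1 (m ε) (hm_pos ε hεmem) (fun θ h2 h3 => by
    have hθ : |θ| ∈ Ioc 0 Real.pi := ⟨hε.trans_le h2, h3⟩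
    exact ⟨exp_I_mul_mem_resolventSet hσ hθ, (hR θ hθ).trans (hm_anti hεmem hθ h2)⟩) n hn1
  have hM0 := hm_pos ε hεmem
  set M := m ε with hM
  have hεM : 1 ≤ ε * M := by
    have hθ : |ε| ∈ Ioc 0 Real.pi := by rwa [abs_of_pos hε]
    have h2 := one_le_dist_mul_norm_resolvent (exp_I_mul_mem_resolventSet hσ hθ) h1
    have h3 := hR ε hθ
    have h4 := Real.norm_exp_I_mul_ofReal_sub_one_le (x := ε)
    rw [abs_of_pos hε] at h3
    rw [norm_sub_rev, Real.norm_eq_abs, abs_of_pos hε] at h4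
    exact h2.trans (by gcongr)
  have hM1 : 1 ≤ M := by nlinarith
  set ℓ := Real.log (1 + M / ε) with hℓ
  have hcn : M * ℓ = c * n := hmn
  have hℓ2 : 1 / 2 ≤ ℓ := by
    have h2 : Real.log 2 ≤ ℓ := by
      refine Real.log_le_log two_pos ?_
      have : 1 ≤ M / ε := by rw [one_le_div hε]; linarith
      linarith
    linarith [Real.log_two_gt_d9]
  have e1 : (n : ℝ) * (c / M) = ℓ := by
    field_simp
    linarith
  have b1 : (1 + M) * Real.exp (-(n * (c / M))) ≤ 2 * ε := by
    rw [e1]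
    calc (1 + M) * Real.exp (-ℓ) ≤ (2 * M) * (ε / M) := by
          gcongr
          · linarith
          · exact exp_neg_log_one_add_div_le hM0 hε
      _ = 2 * ε := by field_simp
  have b2 : (1 + ε * M) / n ≤ 4 * ε := by
    rw [div_le_iff₀ hn0]
    have h2 : M * (1 / 2) ≤ M * ℓ := by gcongr
    have h3 : c * n ≤ 1 * (n : ℝ) := by gcongr
    have h4 : ε * M ≤ ε * (2 * n) := by
      gcongr
      linarith
    linarith
  rw [norm_norm, Real.norm_eq_abs, abs_of_pos hε, mul_assoc]
  refine hest.trans ?_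
  gcongr
  linarith

/-- If `1` is not a spectral value then the spectral radius `r` is less than `1`. The powers of `T`
decay at any exponential rate slower than `r ^ n`, while `m(ε)` is eventually almost
`1 / (1 - r)`. -/
theorem isBigO_of_one_notMem_spectrum [Nontrivial A] {K : ℝ} (hK : ∀ n : ℕ, ‖T ^ n‖ ≤ K)
    (hσ : spectrum ℂ T ∩ Metric.sphere (0 : ℂ) 1 ⊆ {1})
    (hm_cont : ContinuousOn m (Ioc 0 Real.pi)) (hm_pos : ∀ ε ∈ Ioc 0 Real.pi, 0 < m ε)
    (hm_anti : AntitoneOn m (Ioc 0 Real.pi))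
    (hR : ∀ θ : ℝ, |θ| ∈ Ioc 0 Real.pi → ‖resolvent T (Complex.exp (Complex.I * θ))‖ ≤ m |θ|)
    (hc0 : 0 < c) (hc1 : c < 1) (h1 : (1 : ℂ) ∉ spectrum ℂ T) :
    (fun n : ℕ => ‖T ^ n * (1 - T)‖) =O[atTop] (fun n : ℕ => mLogInv m Real.pi (c * n)) := by
  have hπ := Real.pi_gt_three
  obtain ⟨z, hz, hzr⟩ := spectrum.exists_nnnorm_eq_spectralRadius T
  set r := ‖z‖ with hr
  have hr1 : r < 1 := by
    rcases lt_trichotomy r 1 with h | h | h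
    · exact h
    · have : z = 1 := hσ ⟨hz, by simpa using h⟩
      exact absurd (this ▸ hz) h1
    · exact absurd (resolvent_bound_of_one_lt hK h).1 hz
  have hr' : 0 < 1 - r := by linarith
  -- an intermediate constant `c < c' < 1` absorbs the error in `m(ε) ≈ 1 / (1 - r)`
  set c' := (1 + c) / 2 with hc'
  have hc'0 : 0 < c' := by linarith
  have hc'1 : c' < 1 := by linarith
  have hcc' : c < c' := by linarith
  set q := c' / (1 - r) with hq
  have hq0 : 0 < q := by positivity
  obtain ⟨δ, hδ, hmδ⟩ : ∃ δ ∈ Ioc 0 Real.pi, q ≤ m δ := by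
    set d := min 1 ((1 - r) * (1 / c' - 1)) with hd
    have hd0 : 0 < d := by
      have : 1 < 1 / c' := by rwa [lt_div_iff₀ hc'0, one_mul]
      exact lt_min one_pos (mul_pos hr' (by linarith))
    obtain ⟨θ, hθ, hθd⟩ : ∃ θ : ℝ, |θ| ∈ Ioc 0 Real.pi ∧ |z.arg - θ| ≤ d := by
      by_cases h : z.arg = 0
      · refine ⟨d, ?_, ?_⟩
        · rw [abs_of_pos hd0]
          exact ⟨hd0, (min_le_left _ _).trans (by linarith)⟩
        · rw [h, zero_sub, abs_neg, abs_of_pos hd0]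
      · exact ⟨z.arg, ⟨abs_pos.2 h, Complex.abs_arg_le_pi z⟩, by simpa using hd0.le⟩
    refine ⟨|θ|, hθ, ?_⟩
    have h2 := one_le_dist_mul_norm_resolvent (exp_I_mul_mem_resolventSet hσ hθ) hz
    have h3 : ‖z - Complex.exp (Complex.I * θ)‖ ≤ (1 - r) + d := by
      have e1 : z = r * Complex.exp (Complex.I * z.arg) := by
        rw [mul_comm Complex.I]
        exact (Complex.norm_mul_exp_arg_mul_I z).symm
      have e2 : ‖z - Complex.exp (Complex.I * z.arg)‖ = 1 - r := by
        have e5 : z - Complex.exp (Complex.I * z.arg) =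
            ((r : ℂ) - 1) * Complex.exp (Complex.I * z.arg) := by
          rw [sub_mul, one_mul, ← e1]
        rw [e5, norm_mul, Complex.norm_exp_I_mul_ofReal, mul_one, norm_sub_rev,
          ← Complex.ofReal_one, ← Complex.ofReal_sub, Complex.norm_real, Real.norm_eq_abs,
          abs_of_pos hr']
      have e3 : ‖Complex.exp (Complex.I * z.arg) - Complex.exp (Complex.I * θ)‖ ≤ d := by
        have e4 : Complex.exp (Complex.I * z.arg) =
            Complex.exp (Complex.I * ((z.arg - θ : ℝ) : ℂ)) * Complex.exp (Complex.I * θ) := by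
          rw [← Complex.exp_add]
          congr 1
          push_cast
          ring
        rw [e4, ← sub_one_mul, norm_mul, Complex.norm_exp_I_mul_ofReal, mul_one]
        exact Real.norm_exp_I_mul_ofReal_sub_one_le.trans hθd
      have h4 := norm_sub_le_norm_sub_add_norm_sub z (Complex.exp (Complex.I * z.arg))
        (Complex.exp (Complex.I * θ))
      linarith
    have h4 : (1 - r) + d ≤ (1 - r) / c' := by
      have := min_le_right 1 ((1 - r) * (1 / c' - 1))
      calc (1 - r) + d ≤ (1 - r) + (1 - r) * (1 / c' - 1) := by gcongr
        _ = (1 - r) / c' := by ring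
    have h5 : 1 ≤ (1 - r) / c' * m |θ| := h2.trans
      (mul_le_mul (h3.trans h4) (hR θ hθ) (norm_nonneg _) (by positivity))
    rw [hq, div_le_iff₀ hr']
    calc c' = c' * 1 := (mul_one _).symm
      _ ≤ c' * ((1 - r) / c' * m |θ|) := by gcongr
      _ = m |θ| * (1 - r) := by field_simp
  have hgelfand : ∀ᶠ n : ℕ in atTop, ‖T ^ n‖ ≤ Real.exp (-(c * n / q)) := by
    have hs : r < Real.exp (-(c / q)) := by
      have h2 : c / q < 1 - r := by
        rw [hq, div_div_eq_mul_div, div_lt_iff₀ hc'0, mul_comm]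
        gcongr
      have h3 := Real.add_one_le_exp (-(c / q))
      linarith
    have hlt : spectralRadius ℂ T < ENNReal.ofReal (Real.exp (-(c / q))) := by
      rw [← hzr, ← ENNReal.ofReal_coe_nnreal, coe_nnnorm]
      exact (ENNReal.ofReal_lt_ofReal_iff (Real.exp_pos _)).2 hs
    filter_upwards [(spectrum.pow_norm_pow_one_div_tendsto_nhds_spectralRadius T).eventually_lt_const
      hlt, eventually_ge_atTop 1] with n hn hn1
    rw [ENNReal.ofReal_lt_ofReal_iff (Real.exp_pos _)] at hn
    have hn0 : (n : ℝ) ≠ 0 := by positivity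
    have h2 : ‖T ^ n‖ = (‖T ^ n‖ ^ (1 / n : ℝ)) ^ n := by
      rw [← Real.rpow_natCast, ← Real.rpow_mul (norm_nonneg _), one_div_mul_cancel hn0,
        Real.rpow_one]
    have h3 : Real.exp (-(c * n / q)) = Real.exp (-(c / q)) ^ n := by
      rw [← Real.exp_nat_mul]
      congr 1
      ring
    rw [h2, h3]
    gcongr
  refine IsBigO.of_bound (1 / q * ‖1 - T‖) ?_
  filter_upwards [eventually_mLogInv hm_cont hm_pos hm_anti hc0 hδ, hgelfand] with n hn hTn
  set ε := mLogInv m Real.pi (c * n)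
  obtain ⟨hε, hεδ, hmn⟩ := hn
  have hεmem : ε ∈ Ioc 0 Real.pi := ⟨hε, hεδ.trans hδ.2⟩
  have hM0 := hm_pos ε hεmem
  have hqM : q ≤ m ε := hmδ.trans (hm_anti hεmem hδ hεδ)
  have hexp : Real.exp (-(c * n / q)) ≤ ε / q := by
    have h2 : Real.log (1 + m ε / ε) ≤ c * n / q := by
      rw [← hmn, mLog, le_div_iff₀ hq0, mul_comm]
      have : 0 ≤ Real.log (1 + m ε / ε) := Real.log_nonneg (by
        have : 0 < m ε / ε := by positivity
        linarith)
      gcongr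
    calc Real.exp (-(c * n / q)) ≤ Real.exp (-Real.log (1 + m ε / ε)) := by gcongr
      _ ≤ ε / m ε := exp_neg_log_one_add_div_le hM0 hε
      _ ≤ ε / q := by gcongr
  rw [norm_norm, Real.norm_eq_abs, abs_of_pos hε]
  calc ‖T ^ n * (1 - T)‖ ≤ ‖T ^ n‖ * ‖1 - T‖ := norm_mul_le _ _
    _ ≤ ε / q * ‖1 - T‖ := by gcongr; exact hTn.trans hexp
    _ = 1 / q * ‖1 - T‖ * ε := by ring

end Rate

theorem corollary2p5 {X : Type*} [NormedAddCommGroup X] [NormedSpace ℂ X] [CompleteSpace X]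
    (T : X →L[ℂ] X) (hT : IsPowerBounded T)
    (hσ : spectrum ℂ T ∩ Metric.sphere (0 : ℂ) 1 ⊆ {1})
    (m : ℝ → ℝ) (hm_cont : ContinuousOn m (Ioc 0 Real.pi))
    (hm_pos : ∀ ε ∈ Ioc 0 Real.pi, 0 < m ε)
    (hm_anti : AntitoneOn m (Ioc 0 Real.pi))
    (hR : ∀ θ : ℝ, |θ| ∈ Ioc 0 Real.pi →
      ‖resolvent T (Complex.exp (Complex.I * (θ : ℂ)))‖ ≤ m |θ|)
    (c : ℝ) (hc : c ∈ Ioo (0 : ℝ) 1) :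
    (fun n : ℕ => ‖T ^ n * (1 - T)‖) =O[atTop] (fun n : ℕ => mLogInv m Real.pi (c * (n : ℝ))) := by
  obtain ⟨K, hK⟩ := hT
  by_cases h1 : (1 : ℂ) ∈ spectrum ℂ T
  · exact isBigO_of_one_mem_spectrum hK hσ hm_cont hm_pos hm_anti hR hc.1 hc.2 h1
  rcases subsingleton_or_nontrivial X with hX | hX
  · have h0 : (fun n : ℕ => ‖T ^ n * (1 - T)‖) = fun _ => 0 := by
      funext n
      rw [Subsingleton.elim (T ^ n * (1 - T)) 0, norm_zero]
    rw [h0]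
    exact isBigO_zero _ _
  · exact isBigO_of_one_notMem_spectrum hK hσ hm_cont hm_pos hm_anti hR hc.1 hc.2 h1
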